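/- **Setting.** Let $\mathfrak L=\mathfrak L_-\sqcup\mathfrak L_+$ be a set of types, split into noise types and kernel types, with homogeneities $|\mathfrak t|_{\mathfrak s}<0$ for $\mathfrak t\in\mathfrak L_-$ and $|\mathfrak t|_{\mathfrak s}>0$ for $\mathfrak t\in\mathfrak L_+$. Let $\mathfrak s$ be a scaling of $\mathbb R^{d+1}$ with positive integer entries, let $K_{\mathfrak t}$ ($\mathfrak t\in\mathfrak L_+$) be compactly supported integrable kernels on $\mathbb R^{d+1}$, and let $R$ be a normal rule: it assigns to every $\mathfrak t\in\mathfrak L$ a non-empty set $R(\mathfrak t)$ of finite multisets over $\mathfrak L\times\mathbb N^{d+1}$ that is closed under passing to sub-multisets, with $R(\Xi)=\{\emptyset\}$ for $\Xi\in\mathfrak L_-$. Decorated trees $(T^{\mathfrak n,\mathfrak o}_{\mathfrak e},\mathfrak t)$ are finite rooted trees $T$, up to isomorphism, with edge types $\mathfrak t:E(T)\to\mathfrak L$, polynomial decorations $\mathfrak n(x)\in\mathbb N^{d+1}$ and extended decorations $\mathfrak o(x)\in\mathbb Z^{d+1}\oplus\mathbb Z(\mathfrak L)$ at the nodes, and derivative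 decorations $\mathfrak e(e)\in\mathbb N^{d+1}$ on the edges. Set $|\tau|_-=\sum_e(|\mathfrak t(e)|_{\mathfrak s}-|\mathfrak e(e)|_{\mathfrak s})+\sum_x|\mathfrak n(x)|_{\mathfrak s}$ and $|\tau|_+=|\tau|_-+\sum_x|\mathfrak o(x)|_{\mathfrak s}$. Let $\mathcal T^{ex}$ be the span of the trees that strongly conform to $R$ (the node type of $x$, i.e. the multiset of the pairs $(\mathfrak t(e),\mathfrak e(e))$ of the edges leaving $x$ upwards, is in $R(\mathfrak t)$ for the type $\mathfrak t$ of the edge below $x$, and for some $\mathfrak t\in\mathfrak L$ if $x$ is the root) and in which every noise edge ends in a leaf without decorations. Let $\mathcal T_-^{ex}$ be the free commutative algebra over the trees $\tau\in\mathcal T^{ex}$ with $|\tau|_-<0$. Let $\Delta_-^{ex}$ be the extraction-contraction coproduct $$\Delta_-^{ex}\tau=\sum_{A}\sum_{\mathfrak n_A\le\mathfrak n,\ \varepsilon}\frac1{\varepsilon!}\binom{\mathfrak n}{\mathfrak n_A}\,A^{\mathfrak n_A+\pi\varepsilon,\,\mathfrak o}_{\mathfrak e}\otimes(T/A)^{\mathfrak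 n-\mathfrak n_A,\,[\mathfrak o]}_{\mathfrak e+\varepsilon}.$$ Here $A$ runs over the subforests of $T$ and $\varepsilon$ over the $\mathbb N^{d+1}$-valued functions on the edges outside $A$; $\pi\varepsilon(x)$ is the sum of $\varepsilon(e)$ over the edges $e$ that leave $x$ upwards; $T/A$ is $T$ with every component of $A$ contracted to a node; and $[\mathfrak o]$ at that node is the sum over the component of $\mathfrak o+\mathfrak n_A+\pi\varepsilon$ at its nodes and of $\mathfrak t(e)-\mathfrak e(e)$ over its edges. On the left, a single node with zero polynomial decoration is $1$, and every other component of non-negative homogeneity $|\cdot|_-$ vanishes. For a character (unital algebra morphism) $g:\mathcal T_-^{ex}\to\mathbb R$ put $M^g=(g\otimes\mathrm{Id})\Delta_-^{ex}$. For smooth noises $\xi=(\xi_\Xi)_{\Xi\in\mathfrak L_-}$ on $\mathbb R^{d+1}$ and $z\in\mathbb R^{d+1}$, the canonical lift $\Pi_z^\xi$ is the linear map from decorated trees to functions that is multiplicative for the tree product, does not depend on the value of $\mathfrak o$ at the root, and satisfies $\Pi^\xi_zX^n=(\cdot-z)^n$ and $\Pi_z^\xi\mathcal I^{\Xi}_k(\mathbf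 1)=D^k\xi_\Xi$ for $\Xi\in\mathfrak L_-$, and, for $\mathfrak t\in\mathfrak L_+$, $$\Pi^\xi_z\mathcal I^{\mathfrak t}_k\sigma=D^kK_{\mathfrak t}*\Pi^\xi_z\sigma-\sum_{|\ell|_{\mathfrak s}<|\mathcal I^{\mathfrak t}_k\sigma|_+}\frac{(\cdot-z)^\ell}{\ell!}\,\bigl(D^{k+\ell}K_{\mathfrak t}*\Pi^\xi_z\sigma\bigr)(z).$$ **Extensions.** For a finite set $I$, the extension $\hat{\mathcal T}^{ex}[I]$ is built in the same way from the noise types $\mathfrak L_-\sqcup(\mathfrak L_-\times I)$, with $|(\Xi,i)|_{\mathfrak s}=|\Xi|_{\mathfrak s}$. Its rule assigns $\{\emptyset\}$ to every noise type and, to $\mathfrak t\in\mathfrak L_+$, all node types that become elements of $R(\mathfrak t)$ when every $(\Xi,i)$ is replaced by $\Xi$. A character $g$ of $\mathcal T_-^{ex}$ is extended to a character of $\hat{\mathcal T}_-^{ex}[I]$ that vanishes on all trees outside $\mathcal T_-^{ex}$; this defines $M^g$ on the extension too. Let $I=\{\mathfrak h\}$ and $J=\{\mathfrak h,\mathfrak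 k,\mathfrak h-\mathfrak k\}$. Write $\hat\Pi_z^{f,h}$ for the canonical lift of $(f,h)$ on $\hat{\mathcal T}^{ex}[I]$, and $\hat\Pi_z^{f,h,k,h-k}$ for that of $(f,h,k,h-k)$ on $\hat{\mathcal T}^{ex}[J]$. **Telescoping operator.** For every decorated tree $(\tau,\mathfrak t)$ of the extension by $I$ fix an arbitrary total order $\preceq$ on the set $\hat L(\tau)$ of edges with type in $\mathfrak L_-\times I$. Let $\mathcal A$ be the linear operator with $\mathcal A(\tau,\mathfrak t)=\sum_{u\in\hat L(\tau)}(\tau,\mathfrak t[u])$. Here $\mathfrak t[u]$ agrees with $\mathfrak t$ outside $\hat L(\tau)$, and replaces the type $(\Xi,\mathfrak h)$ of $e\in\hat L(\tau)$ by $(\Xi,\mathfrak h)$ if $e\prec u$, by $(\Xi,\mathfrak h-\mathfrak k)$ if $e=u$, and by $(\Xi,\mathfrak k)$ if $u\prec e$. **Lemma.** For all families $f,h,k\in C^\infty(\mathbb R^{d+1})^{\mathfrak L_-}$, every character $g$ of $\mathcal T_-^{ex}$, every $z\in\mathbb R^{d+1}$ and every such choice of total orders, $$\hat\Pi_z^{f,h}M^g-\hat\Pi_z^{f,k}M^g=\hat\Pi_z^{f,h,k,h-k}M^g\mathcal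 A\qquad\text{on }\hat{\mathcal T}^{ex}[I].$$ -/

import Mathlib

open scoped ContDiff TensorProduct

noncomputable section

namespace RegStr

universe u v w

/-! ## Decorated trees -/

/-- Multi-indices in `ℕ^{d+1}`. -/
abbrev MI (d : ℕ) : Type := Fin (d + 1) → ℕ

/-- Space-time `ℝ^{d+1}`. -/
abbrev Space (d : ℕ) : Type := Fin (d + 1) → ℝ

/-- Values `ℤ^{d+1} ⊕ ℤ(𝔏)` of the extended decoration `𝔬`. -/
abbrev ODec (L : Type u) (d : ℕ) : Type u := (Fin (d + 1) → ℤ) × (L →₀ ℤ)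

/-- Concrete (planar) representatives of rooted decorated trees with edge types in `L`.
`root n o` is the tree with a single node, decorated by `𝔫 = n`, `𝔬 = o`; `graft t k σ τ` is
obtained from `τ` by adding at its root a new edge of type `t` with edge decoration `𝔢 = k`,
leading to the root of `σ`, that is `𝓘^t_k(σ) · τ`. -/
inductive PTree (L : Type u) (d : ℕ) : Type u
  | root (n : MI d) (o : ODec L d) : PTree L d
  | graft (t : L) (k : MI d) (σ τ : PTree L d) : PTree L d

/-- Isomorphism of decorated trees: the order of the branches at a node is irrelevant. -/
inductive PTree.Iso {L : Type u} {d : ℕ} : PTree L d → PTree L d → Prop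
  | refl (τ : PTree L d) : PTree.Iso τ τ
  | symm {σ τ : PTree L d} : PTree.Iso σ τ → PTree.Iso τ σ
  | trans {ρ σ τ : PTree L d} : PTree.Iso ρ σ → PTree.Iso σ τ → PTree.Iso ρ τ
  | congr (t : L) (k : MI d) {σ σ' τ τ' : PTree L d} :
      PTree.Iso σ σ' → PTree.Iso τ τ' → PTree.Iso (.graft t k σ τ) (.graft t k σ' τ')
  | swap (t t' : L) (k k' : MI d) (σ σ' τ : PTree L d) :
      PTree.Iso (.graft t k σ (.graft t' k' σ' τ)) (.graft t' k' σ' (.graft t k σ τ))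

instance PTree.setoid (L : Type u) (d : ℕ) : Setoid (PTree L d) where
  r := PTree.Iso
  iseqv := ⟨PTree.Iso.refl, PTree.Iso.symm, PTree.Iso.trans⟩

/-- Decorated trees `(T^{𝔫,𝔬}_𝔢, 𝔱)`, that is, isomorphism classes of concrete trees. -/
def Tree (L : Type u) (d : ℕ) : Type u := Quotient (PTree.setoid L d)

/-- A function on concrete trees that is defined by recursion over the branches, in a way that
does not depend on their order, is constant on isomorphism classes. -/
theorem PTree.Iso.map_eq {L : Type u} {d : ℕ} {α : Type v} (F : PTree L d → α)
    (hc : ∀ t k σ σ' τ τ', F σ = F σ' → F τ = F τ' → PTree.Iso σ σ' →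
      F (.graft t k σ τ) = F (.graft t k σ' τ'))
    (hs : ∀ t t' k k' σ σ' τ, F (.graft t k σ (.graft t' k' σ' τ)) =
      F (.graft t' k' σ' (.graft t k σ τ)))
    {σ τ : PTree L d} (h : PTree.Iso σ τ) : F σ = F τ := by
  induction h with
  | refl => rfl
  | symm _ ih => exact ih.symm
  | trans _ _ ih ih' => exact ih.trans ih'
  | congr t k h _ ih ih' => exact hc t k _ _ _ _ ih ih' h
  | swap => exact hs _ _ _ _ _ _ _

theorem PTree.Iso.root_iff {L : Type u} {d : ℕ} {n : MI d} {o : ODec L d} {σ τ : PTree L d}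
    (h : PTree.Iso σ τ) : σ = .root n o ↔ τ = .root n o := by
  induction h with
  | refl => rfl
  | symm _ ih => exact ih.symm
  | trans _ _ ih ih' => exact ih.trans ih'
  | congr => simp
  | swap => simp

namespace Tree

variable {L : Type u} {d : ℕ}

/-- The tree with a single node. -/
def root (n : MI d) (o : ODec L d) : Tree L d := Quotient.mk _ (.root n o)

/-- `graft t k σ τ = 𝓘^t_k(σ) · τ`. -/
def graft (t : L) (k : MI d) : Tree L d → Tree L d → Tree L d :=
  Quotient.map₂ (PTree.graft t k) fun _ _ h _ _ h' => PTree.Iso.congr t k h h'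

theorem graft_left_comm (t t' : L) (k k' : MI d) (σ σ' τ : Tree L d) :
    graft t k σ (graft t' k' σ' τ) = graft t' k' σ' (graft t k σ τ) := by
  induction σ using Quotient.inductionOn
  induction σ' using Quotient.inductionOn
  induction τ using Quotient.inductionOn
  exact Quotient.sound (PTree.Iso.swap _ _ _ _ _ _ _)

/-- The branches above a node: edge type, edge decoration, and the tree that the edge leads to. -/
abbrev Branches (L : Type u) (d : ℕ) : Type u := Multiset (L × MI d × Tree L d)

/-- A tree in exploded form: the decorations `𝔫`, `𝔬` of its root and its branches. Addition in
this commutative monoid is the tree product (join the roots and add their decorations). -/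
abbrev Exploded (L : Type u) (d : ℕ) : Type u := MI d × ODec L d × Branches L d

instance graft_leftCommutative :
    LeftCommutative (fun (b : L × MI d × Tree L d) (τ : Tree L d) => graft b.1 b.2.1 b.2.2 τ) :=
  ⟨fun _ _ _ => graft_left_comm _ _ _ _ _ _ _⟩

/-- The tree with a given root and given branches. -/
def assemble (x : Exploded L d) : Tree L d :=
  x.2.2.foldr (fun b τ => graft b.1 b.2.1 b.2.2 τ) (root x.1 x.2.1)

end Tree

/-- Change of the types in the extended decoration. -/
def ODec.map {L : Type u} {L' : Type v} {d : ℕ} (φ : L → L') (o : ODec L d) : ODec L' d :=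
  (o.1, o.2.mapDomain φ)

/-- Apply `φ` to all the types that occur in a tree. -/
def PTree.map {L : Type u} {L' : Type v} {d : ℕ} (φ : L → L') : PTree L d → PTree L' d
  | .root n o => .root n (o.map φ)
  | .graft t k σ τ => .graft (φ t) k (σ.map φ) (τ.map φ)

theorem PTree.Iso.map {L : Type u} {L' : Type v} {d : ℕ} (φ : L → L') {σ τ : PTree L d}
    (h : PTree.Iso σ τ) : PTree.Iso (σ.map φ) (τ.map φ) := by
  induction h with
  | refl => exact .refl _
  | symm _ ih => exact .symm ih
  | trans _ _ ih ih' => exact .trans ih ih'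
  | congr t k _ _ ih ih' => exact .congr _ _ ih ih'
  | swap => exact .swap _ _ _ _ _ _ _

/-- Apply `φ` to all the types that occur in a tree. -/
def Tree.map {L : Type u} {L' : Type v} {d : ℕ} (φ : L → L') : Tree L d → Tree L' d :=
  Quotient.map (PTree.map φ) fun _ _ h => h.map φ

/-- The edges of a concrete tree. In `graft t k σ τ`, `none` is the new edge. -/
def PTree.Edge {L : Type u} {d : ℕ} : PTree L d → Type
  | .root _ _ => Empty
  | .graft _ _ σ τ => Option (PTree.Edge σ ⊕ PTree.Edge τ)

instance PTree.Edge.fintype {L : Type u} {d : ℕ} : (τ : PTree L d) → Fintype τ.Edge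
  | .root _ _ => inferInstanceAs (Fintype Empty)
  | .graft _ _ σ τ =>
    let _ := PTree.Edge.fintype σ
    let _ := PTree.Edge.fintype τ
    inferInstanceAs (Fintype (Option (PTree.Edge σ ⊕ PTree.Edge τ)))

/-- The type map `𝔱 : E(τ) → L`. -/
def PTree.typ {L : Type u} {d : ℕ} : (τ : PTree L d) → τ.Edge → L
  | .root _ _ => fun e => Empty.elim e
  | .graft t _ σ τ => fun e => match e with
    | none => t
    | some (Sum.inl e) => PTree.typ σ e
    | some (Sum.inr e) => PTree.typ τ e

/-- The tree `(τ, 𝔱')` with the type map replaced by `𝔱'`; `φ` is applied to the types that are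
recorded in the extended decoration. -/
def PTree.retype {L : Type u} {L' : Type v} {d : ℕ} (φ : L → L') :
    (τ : PTree L d) → (τ.Edge → L') → PTree L' d
  | .root n o => fun _ => .root n (o.map φ)
  | .graft _ k σ τ => fun t' => .graft (t' none) k
      (PTree.retype φ σ fun e => t' (some (Sum.inl e)))
      (PTree.retype φ τ fun e => t' (some (Sum.inr e)))

/-- The node type of the root: the multiset of all `(𝔱(e), 𝔢(e))` for edges `e` at the root. -/
def PTree.nodeType {L : Type u} {d : ℕ} : PTree L d → Multiset (L × MI d)
  | .root _ _ => 0
  | .graft t k _ τ => (t, k) ::ₘ τ.nodeType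

theorem PTree.Iso.nodeType {L : Type u} {d : ℕ} {σ τ : PTree L d} (h : PTree.Iso σ τ) :
    σ.nodeType = τ.nodeType :=
  PTree.Iso.map_eq PTree.nodeType (fun t k _ _ _ _ _ h _ => by simp [PTree.nodeType, h])
    (fun _ _ _ _ _ _ _ => Multiset.cons_swap _ _ _) h

/-! ## Types, homogeneities, kernels and rules -/

/-- The data from which the regularity structure and its models are built: a scaling, the
homogeneities of the noise types `N` (negative) and of the kernel types `P` (positive), a kernel
for every kernel type and a normal rule. Types are the elements of `N ⊕ P`. Kernels that are smooth
away from the origin, compactly supported and singular of order `|𝔱| - |𝔰|` at the origin are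
integrable since `|𝔱| > 0`; no more than integrability is asked for. -/
structure Data (N : Type u) (P : Type v) (d : ℕ) where
  /-- the scaling `𝔰` -/
  scaling : MI d
  scaling_pos : ∀ i, 0 < scaling i
  /-- homogeneities of noise types -/
  noiseDeg : N → ℝ
  noiseDeg_neg : ∀ t, noiseDeg t < 0
  /-- homogeneities of kernel types -/
  kernelDeg : P → ℝ
  kernelDeg_pos : ∀ t, 0 < kernelDeg t
  /-- the kernels `K_𝔱` -/
  kernel : P → Space d → ℝ
  kernel_compact : ∀ t, HasCompactSupport (kernel t)
  kernel_integrable : ∀ t, MeasureTheory.Integrable (kernel t)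
  /-- the rule `R` -/
  rule : N ⊕ P → Set (Multiset ((N ⊕ P) × MI d))
  rule_nonempty : ∀ t, (rule t).Nonempty
  rule_noise : ∀ t, rule (Sum.inl t) = {0}
  rule_normal : ∀ t, ∀ A ∈ rule t, ∀ B ≤ A, B ∈ rule t

/-- The extended types `(N ⊔ N × I) ⊔ P`. -/
abbrev ExtTypes (N : Type u) (P : Type v) (I : Type) : Type (max u v) := (N ⊕ N × I) ⊕ P

/-- The projection `𝔮` from extended types to types, `(Ξ, i) ↦ Ξ`. -/
def forget {N : Type u} {P : Type v} {I : Type} : ExtTypes N P I → N ⊕ P :=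
  Sum.map (Sum.elim id Prod.fst) id

/-- The inclusion of the types into the extended types. -/
def embed {N : Type u} {P : Type v} {I : Type} : N ⊕ P → ExtTypes N P I :=
  Sum.map Sum.inl id

/-- The extended data: `|(Ξ, i)| = |Ξ|`, the kernels are unchanged, and the extended rule allows
every occurrence of a noise type `Ξ` to be replaced by some `(Ξ, i)`. -/
def Data.ext {N : Type u} {P : Type v} {d : ℕ} (D : Data N P d) (I : Type) :
    Data (N ⊕ N × I) P d where
  scaling := D.scaling
  scaling_pos := D.scaling_pos
  noiseDeg := Sum.elim D.noiseDeg fun t => D.noiseDeg t.1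
  noiseDeg_neg := by
    rintro (t | t)
    · exact D.noiseDeg_neg t
    · exact D.noiseDeg_neg t.1
  kernelDeg := D.kernelDeg
  kernelDeg_pos := D.kernelDeg_pos
  kernel := D.kernel
  kernel_compact := D.kernel_compact
  kernel_integrable := D.kernel_integrable
  rule := Sum.elim (fun _ => {0})
    fun t => {A | A.map (fun x => (forget x.1, x.2)) ∈ D.rule (Sum.inr t)}
  rule_nonempty := by
    rintro (t | t)
    · exact ⟨0, rfl⟩
    · obtain ⟨A, hA⟩ := D.rule_nonempty (Sum.inr t)
      exact ⟨0, D.rule_normal _ A hA _ (Multiset.zero_le _)⟩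
  rule_noise := fun _ => rfl
  rule_normal := by
    rintro (t | t) A hA B hB
    · have hA : A = 0 := hA
      subst hA
      exact Multiset.le_zero.1 hB
    · exact D.rule_normal _ _ hA _ (Multiset.map_le_map hB)

/-- The scaled degree `|n|_𝔰` of a multi-index. -/
def Data.sdeg {N : Type u} {P : Type v} {d : ℕ} (D : Data N P d) (n : MI d) : ℕ :=
  ∑ i, D.scaling i * n i

/-- The homogeneity of a type. -/
def Data.tdeg {N : Type u} {P : Type v} {d : ℕ} (D : Data N P d) : N ⊕ P → ℝ :=
  Sum.elim D.noiseDeg D.kernelDeg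

/-- The homogeneity of a value of the extended decoration. -/
def Data.odeg {N : Type u} {P : Type v} {d : ℕ} (D : Data N P d) (o : ODec (N ⊕ P) d) : ℝ :=
  (∑ i, (D.scaling i : ℝ) * (o.1 i : ℝ)) + o.2.sum fun t c => (c : ℝ) * D.tdeg t

namespace PTree

variable {N : Type u} {P : Type v} {d : ℕ} (D : Data N P d)

/-- The homogeneity `|τ|_-`, which ignores the extended decoration. -/
def degMinus : PTree (N ⊕ P) d → ℝ
  | .root n _ => D.sdeg n
  | .graft t k σ τ => (D.tdeg t - D.sdeg k) + degMinus σ + degMinus τ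

/-- The homogeneity `|τ|_+`, which takes the extended decoration into account. -/
def degPlus : PTree (N ⊕ P) d → ℝ
  | .root n o => D.sdeg n + D.odeg o
  | .graft t k σ τ => (D.tdeg t - D.sdeg k) + degPlus σ + degPlus τ

/-- The rule is obeyed at every node other than the root. A noise edge ends in a bare node (no
branches and no decorations). -/
def Conforms : PTree (N ⊕ P) d → Prop
  | .root _ _ => True
  | .graft t _ σ τ =>
      (Sum.elim (fun _ => σ = .root 0 0)
        (fun p => σ.nodeType ∈ D.rule (Sum.inr p) ∧ Conforms σ) t) ∧ Conforms τ

/-- The tree strongly conforms to the rule: the rule is obeyed at every node, the root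
included. -/
def StronglyConforms (τ : PTree (N ⊕ P) d) : Prop :=
  τ.Conforms D ∧ ∃ t, τ.nodeType ∈ D.rule t

theorem Iso.degMinus_eq {σ τ : PTree (N ⊕ P) d} (h : PTree.Iso σ τ) :
    σ.degMinus D = τ.degMinus D :=
  h.map_eq _ (fun _ _ _ _ _ _ h h' _ => by simp [degMinus, h, h'])
    (fun _ _ _ _ _ _ _ => by simp only [degMinus]; ring)

theorem Iso.degPlus_eq {σ τ : PTree (N ⊕ P) d} (h : PTree.Iso σ τ) :
    σ.degPlus D = τ.degPlus D :=
  h.map_eq _ (fun _ _ _ _ _ _ h h' _ => by simp [degPlus, h, h'])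
    (fun _ _ _ _ _ _ _ => by simp only [degPlus]; ring)

theorem Iso.conforms_eq {σ τ : PTree (N ⊕ P) d} (h : PTree.Iso σ τ) :
    σ.Conforms D = τ.Conforms D :=
  h.map_eq _ (fun t _ _ _ _ _ h h' hi => by
      rcases t with t | t
      · simp [Conforms, h', hi.root_iff]
      · simp [Conforms, h, h', hi.nodeType])
    (fun _ _ _ _ _ _ _ => by simp only [Conforms, eq_iff_iff]; tauto)

end PTree

namespace Data

variable {N : Type u} {P : Type v} {d : ℕ} (D : Data N P d)

/-- The homogeneity `|τ|_-` of a tree. -/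
def degMinus : Tree (N ⊕ P) d → ℝ :=
  Quotient.lift (PTree.degMinus D) fun _ _ h => PTree.Iso.degMinus_eq D h

/-- The set of decorated trees that span `𝓣^ex`: those that strongly conform to the rule. The values
of the extended decoration (except at the ends of noise edges) are not restricted any further. -/
def trees : Set (Tree (N ⊕ P) d) :=
  {τ | Quotient.lift (PTree.StronglyConforms D) (fun σ τ h => by
    have h : PTree.Iso σ τ := h
    simp [PTree.StronglyConforms, h.conforms_eq D, h.nodeType]) τ}

/-- Formal linear combinations of decorated trees. -/
abbrev Span (_D : Data N P d) : Type (max u v) := Tree (N ⊕ P) d →₀ ℝ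

/-- The space `𝓣^ex` spanned by the decorated trees that strongly conform to the rule. -/
def Tex : Submodule ℝ D.Span := Finsupp.supported ℝ ℝ D.trees

/-- The trees in `𝓣^ex` with `|τ|_- < 0`. -/
def NegTree : Type (max u v) := {τ : Tree (N ⊕ P) d // τ ∈ D.trees ∧ D.degMinus τ < 0}

/-- The algebra `𝓣_-^ex`: the free commutative algebra over the trees of negative homogeneity;
the product is the forest product. -/
abbrev TMinus : Type (max u v) := MvPolynomial D.NegTree ℝ

/-! ## The coproduct `Δ_-^ex` and the renormalization maps `M^g` -/

/-- A connected component of a subforest, seen as an element of `𝓣_-^ex`: a single node without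
polynomial decoration is the empty forest, and everything that is not of negative homogeneity
vanishes. -/
def component (C : Tree.Exploded (N ⊕ P) d) : D.TMinus :=
  open Classical in
  if C.2.2 = 0 then (if C.1 = 0 then 1 else 0)
  else if h : Tree.assemble C ∈ D.trees ∧ D.degMinus (Tree.assemble C) < 0 then
    MvPolynomial.X ⟨Tree.assemble C, h⟩
  else 0

/-- Formal sums over subforests `A` of a given tree. The term of `A` is recorded at the pair `(C, Q)`
of the component `C` of `A` that contains the root and the contracted tree `Q`, and its coefficient
is the product of a combinatorial factor and all the other components of `A`. -/
abbrev Cuts : Type (max u v) :=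
  AddMonoidAlgebra D.TMinus (Tree.Exploded (N ⊕ P) d × Tree.Exploded (N ⊕ P) d)

/-- A multi-index as an extended decoration. -/
def polyO (m : MI d) : ODec (N ⊕ P) d := (fun i => (m i : ℤ), 0)

/-- The contribution `𝔱(e) - 𝔢(e)` of a contracted edge to the extended decoration. -/
def edgeO (t : N ⊕ P) (k : MI d) : ODec (N ⊕ P) d :=
  (fun i => -(k i : ℤ), Finsupp.single t 1)

/-- The factor of a node: `∑_{m ≤ n} (n choose m)`, where `m = 𝔫_A` stays in `A`, and the
contracted tree has the decorations `n - m` and `o + m`. -/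
def cutNode (n : MI d) (o : ODec (N ⊕ P) d) : D.Cuts :=
  ∑ m ∈ Finset.Iic n, AddMonoidAlgebra.single
    (((m, o, 0), (n - m, o + polyO m, 0)) :
      Tree.Exploded (N ⊕ P) d × Tree.Exploded (N ⊕ P) d)
    (MvPolynomial.C ((∏ i, (n i).choose (m i) : ℕ) : ℝ))

/-- The factor of an edge `e` of type `t` and decoration `k` with the subtree above it. Either `e`
belongs to `A`: then it is kept in `A` and contracted in `Q`. Or it does not: then the component
`C` above `e` is complete, `e` is kept in `Q`, and there is a sum over `ε = ε_A(e)` with weight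
`1 / ε!`, where `ε` is added to `𝔢(e)` in `Q`, to the polynomial decoration of `A` at the lower end
of `e`, and to the extended decoration of `Q` there. Only `ε` with entries up to `b` are listed. -/
def cutEdge (b : ℕ) (t : N ⊕ P) (k : MI d) (S : D.Cuts) : D.Cuts :=
  S.coeff.sum fun x p =>
    AddMonoidAlgebra.single
      ((0, 0, {(t, k, Tree.assemble x.1)}), (x.2.1, x.2.2.1 + edgeO t k, x.2.2.2)) p
    + ∑ ε ∈ Finset.Iic (fun _ => b : MI d), AddMonoidAlgebra.single
        (((ε, 0, 0), (0, polyO ε, {(t, k + ε, Tree.assemble x.2)})) :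
          Tree.Exploded (N ⊕ P) d × Tree.Exploded (N ⊕ P) d)
        (MvPolynomial.C ((∏ i, (ε i).factorial : ℕ) : ℝ)⁻¹ * D.component x.1 * p)

/-- The sum over all subforests of a tree, expanded as a product over its nodes and edges. -/
def cuts (b : ℕ) : PTree (N ⊕ P) d → D.Cuts
  | .root n o => D.cutNode n o
  | .graft t k σ τ => D.cutEdge b t k (cuts b σ) * cuts b τ

/-- The total negative homogeneity of the edges. A component of a subforest in which some
`ε` with an entry above the bound below takes part is not of negative homogeneity, so that its
term vanishes in `𝓣_-^ex` and the sum over all `ε` reduces to a finite one. -/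
def negPart : PTree (N ⊕ P) d → ℝ
  | .root _ _ => 0
  | .graft t k σ τ => max 0 (D.sdeg k - D.tdeg t) + negPart σ + negPart τ

/-- An upper bound for the entries of the multi-indices `ε`. -/
def epsBound (τ : PTree (N ⊕ P) d) : ℕ := ⌈D.negPart τ⌉₊

/-- `Δ_-^ex` on a concrete tree: the sum over all subforests `A` of
`(forest of the components of A) ⊗ (tree with all components of A contracted)`. -/
def coprodPTree (τ : PTree (N ⊕ P) d) : D.TMinus ⊗[ℝ] D.Span :=
  (D.cuts (D.epsBound τ) τ).coeff.sum fun x p =>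
    (D.component x.1 * p) ⊗ₜ[ℝ] Finsupp.single (Tree.assemble x.2) (1 : ℝ)

theorem negPart_eq {σ τ : PTree (N ⊕ P) d} (h : PTree.Iso σ τ) : D.negPart σ = D.negPart τ :=
  h.map_eq _ (fun _ _ _ _ _ _ h h' _ => by simp [negPart, h, h'])
    (fun _ _ _ _ _ _ _ => by simp only [negPart]; ring)

theorem cuts_eq (b : ℕ) {σ τ : PTree (N ⊕ P) d} (h : PTree.Iso σ τ) : D.cuts b σ = D.cuts b τ :=
  h.map_eq _ (fun _ _ _ _ _ _ h h' _ => by simp [cuts, h, h'])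
    (fun _ _ _ _ _ _ _ => by simp only [cuts]; exact mul_left_comm _ _ _)

/-- `Δ_-^ex` on a tree. -/
def coprodTree : Tree (N ⊕ P) d → D.TMinus ⊗[ℝ] D.Span :=
  Quotient.lift D.coprodPTree fun σ τ h => by
    have h : PTree.Iso σ τ := h
    simp only [coprodPTree, epsBound, D.negPart_eq h, D.cuts_eq _ h]

/-- The extraction-contraction coproduct `Δ_-^ex`. -/
def coprod : D.Span →ₗ[ℝ] D.TMinus ⊗[ℝ] D.Span :=
  Finsupp.linearCombination ℝ D.coprodTree

/-- The renormalization map `M^g = (g ⊗ Id) Δ_-^ex` of a character `g` of `𝓣_-^ex`. -/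
def renorm (g : D.TMinus →ₐ[ℝ] ℝ) : D.Span →ₗ[ℝ] D.Span :=
  (TensorProduct.lid ℝ D.Span).toLinearMap ∘ₗ
    LinearMap.rTensor D.Span g.toLinearMap ∘ₗ D.coprod

/-- A character of `𝓣_-^ex` as a character of the extended `𝓣_-^ex[I]`: it vanishes on all trees
outside of `𝓣_-^ex`. -/
def extendChar (g : D.TMinus →ₐ[ℝ] ℝ) (I : Type) : (D.ext I).TMinus →ₐ[ℝ] ℝ :=
  MvPolynomial.aeval fun τ : (D.ext I).NegTree =>
    Function.extend (fun σ : D.NegTree => Tree.map embed σ.1)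
      (fun σ => g (MvPolynomial.X σ)) 0 τ.1

end Data

/-! ## The canonical lift -/

/-- `x^n` for a multi-index `n`. -/
def mono {d : ℕ} (x : Space d) (n : MI d) : ℝ := ∏ i, x i ^ n i

/-- The partial derivative in direction `i`. -/
def partialD {d : ℕ} (i : Fin (d + 1)) (φ : Space d → ℝ) : Space d → ℝ :=
  fun x => fderiv ℝ φ x (Pi.single i 1)

/-- The derivative `D^k` for a multi-index `k`. -/
def multiD {d : ℕ} (k : MI d) (φ : Space d → ℝ) : Space d → ℝ :=
  (List.finRange (d + 1)).foldr (fun i ψ => (partialD i)^[k i] ψ) φ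

namespace Data

variable {N : Type u} {P : Type v} {d : ℕ} (D : Data N P d)

/-- The function `D^k K_t * φ = K_t * D^k φ` for smooth `φ`, where `D^k K_t` is the distributional
derivative. -/
def kernelConv (t : P) (k : MI d) (φ : Space d → ℝ) : Space d → ℝ :=
  fun y => ∫ x, D.kernel t x * multiD k φ (y - x)

/-- The multi-indices `ℓ` with `|ℓ|_𝔰 < α`. -/
def jets (α : ℝ) : Finset (MI d) :=
  open Classical in
  (Finset.Iic (fun _ => ⌈α⌉₊ : MI d)).filter fun l => (D.sdeg l : ℝ) < α

/-- The canonical lift `Π_z` of smooth noises `ξ` on a concrete tree: `Π_z` is multiplicative,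
`Π_z X^n = (· - z)^n`, `Π_z Ξ = ξ_Ξ`, and with `α = |𝓘^t_k σ|_+`
`Π_z 𝓘^t_k σ = D^k K_t * Π_z σ - ∑_{|ℓ| < α} (· - z)^ℓ / ℓ! (D^{k+ℓ} K_t * Π_z σ)(z)`. -/
def modelPTree (ξ : N → Space d → ℝ) (z : Space d) : PTree (N ⊕ P) d → Space d → ℝ
  | .root n _ => fun y => mono (y - z) n
  | .graft (.inl t) k _ τ => fun y => multiD k (ξ t) y * modelPTree ξ z τ y
  | .graft (.inr t) k σ τ => fun y =>
      (D.kernelConv t k (modelPTree ξ z σ) y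
        - ∑ l ∈ D.jets (D.kernelDeg t - D.sdeg k + σ.degPlus D),
            mono (y - z) l / ((∏ i, (l i).factorial : ℕ) : ℝ)
              * D.kernelConv t (k + l) (modelPTree ξ z σ) z)
        * modelPTree ξ z τ y

theorem modelPTree_eq (ξ : N → Space d → ℝ) (z : Space d) {σ τ : PTree (N ⊕ P) d}
    (h : PTree.Iso σ τ) : D.modelPTree ξ z σ = D.modelPTree ξ z τ :=
  h.map_eq _ (fun t _ _ _ _ _ h h' hi => by
      rcases t with t | t
      · simp [modelPTree, h']
      · simp [modelPTree, h, h', hi.degPlus_eq D])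
    (fun t t' _ _ _ _ _ => by
      rcases t with t | t <;> rcases t' with t' | t' <;> funext y <;> simp only [modelPTree] <;> ring)

/-- The canonical lift `Π_z` of smooth noises `ξ`, as a linear map into functions. -/
def model (ξ : N → Space d → ℝ) (z : Space d) : D.Span →ₗ[ℝ] (Space d → ℝ) :=
  Finsupp.linearCombination ℝ
    (Quotient.lift (D.modelPTree ξ z) fun _ _ h => D.modelPTree_eq ξ z h :
      Tree (N ⊕ P) d → Space d → ℝ)

end Data

/-- The noises `(f, (h_i)_{i ∈ I})` on the extended noise types. -/
def extNoise {N : Type u} {d : ℕ} {I : Type} (f : N → Space d → ℝ) (h : I → N → Space d → ℝ) :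
    N ⊕ N × I → Space d → ℝ :=
  Sum.elim f fun t => h t.2 t.1

/-! ## The telescoping operator -/

/-- The index set `{𝔥}`. -/
inductive IdxI : Type
  | h

/-- The index set `{𝔥, 𝔨, 𝔥 - 𝔨}`. -/
inductive IdxJ : Type
  | h
  | k
  | hk

/-- The noises `(h, k, h - k)`, indexed by `{𝔥, 𝔨, 𝔥 - 𝔨}`. -/
def noiseJ {N : Type u} {d : ℕ} (h k : N → Space d → ℝ) : IdxJ → N → Space d → ℝ
  | .h => h
  | .k => k
  | .hk => h - k

section Telescope

variable {N : Type u} {P : Type v} {d : ℕ}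

/-- The type belongs to `N × I`. -/
def IsHat {I : Type} (t : ExtTypes N P I) : Prop := ∃ a : N × I, t = Sum.inl (Sum.inr a)

/-- Replace the index of a type in `N × I` by `j`; other types are left unchanged. -/
def setIdx {I J : Type} (j : J) : ExtTypes N P I → ExtTypes N P J :=
  Sum.map (Sum.map id fun a => (a.1, j)) id

/-- The set `L̂(τ)` of noise edges with type in `N × I`. -/
def HatLeaf {I : Type} (τ : PTree (ExtTypes N P I) d) : Type :=
  {e : τ.Edge // IsHat (τ.typ e)}

instance HatLeaf.fintype {I : Type} (τ : PTree (ExtTypes N P I) d) : Fintype (HatLeaf τ) :=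
  open Classical in inferInstanceAs (Fintype {e : τ.Edge // IsHat (τ.typ e)})

/-- The type map `𝔱[u]`: it has index `𝔥 - 𝔨` at `u`, index `𝔥` on the elements of `L̂(τ)` before
`u`, index `𝔨` on those after `u`, and agrees with `𝔱` on all the other edges. -/
def teleType (τ : PTree (ExtTypes N P IdxI) d) (ord : LinearOrder (HatLeaf τ)) (u : HatLeaf τ)
    (e : τ.Edge) : ExtTypes N P IdxJ :=
  open Classical in
  setIdx
    (if he : IsHat (τ.typ e) then
      (if ord.lt ⟨e, he⟩ u then IdxJ.h else if u = ⟨e, he⟩ then IdxJ.hk else IdxJ.k)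
    else IdxJ.h)
    (τ.typ e)

/-- The operator `𝓐 (τ, 𝔱) = ∑_{u ∈ L̂(τ)} (τ, 𝔱[u])`, for a choice of a total order on `L̂(τ)` for
every tree `τ` (the edges of `τ` being those of some fixed concrete representative). -/
def telescope
    (ord : ∀ τ : Tree (ExtTypes N P IdxI) d, LinearOrder (HatLeaf (Quotient.out τ))) :
    (Tree (ExtTypes N P IdxI) d →₀ ℝ) →ₗ[ℝ] (Tree (ExtTypes N P IdxJ) d →₀ ℝ) :=
  Finsupp.linearCombination ℝ fun τ =>
    ∑ u : HatLeaf (Quotient.out τ),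
      Finsupp.single
        (Quotient.mk _ ((Quotient.out τ).retype (setIdx IdxJ.h)
          (teleType (Quotient.out τ) (ord τ) u)) : Tree (ExtTypes N P IdxJ) d)
        (1 : ℝ)

end Telescope

end RegStr

end

/-! Fix a tree and regard its renormalized canonical lift as a function of the noises placed on the
individual edges of `L̂(τ)`. This function is additive in each of them. A subforest containing such
an edge contributes nothing, because the extended character vanishes on every tree outside `𝓣_-^ex`.
In every remaining term the edge survives in the contracted tree, and its noise enters only through
linear operations: derivatives, products with other factors, and convolution with a kernel minus a
Taylor polynomial, whose order is fixed by homogeneities and not by the noise. Let `F(S)` be the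
value with `h` on `S` and `k` on the rest of `L̂(τ)`. Additivity in the slot `u` shows that `F({≤
u}) - F({< u})` is the value with `h - k` at `u`, and summing over `u` telescopes
(`sum_sub_of_linearOrder`).

To make this precise, the sum over subforests has to be evaluated along the recursion of the tree,
although the component at the root is still growing there and the character cannot yet be applied to
it. The ring homomorphism `cutsValue` therefore keeps the root component as a formal symbol,
discards it if it contains an edge of `L̂`, and replaces the contracted tree by its lift together
with its homogeneity `|·|_+`, which is all that the next integration needs. `cutsValue_cuts`
identifies the result with `expansion`, in which the noises are free parameters; `expansion_add` is
the additivity in one slot; `pairing` finally applies the character (`model_renorm`).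

The two sides live in different extensions. They become values of one function of the noises because
the character is unaffected by injective reindexing (`treeValue_reindex`), the indices of the edges
in `L̂` leave no trace apart from their noise (`noiseEdge_setIdx`), and homogeneities, hence Taylor
orders and the cutoff for `ε`, ignore indices (`odeg_ext_map`, `epsBound_retype`). -/

noncomputable section

namespace RegStr

universe u v w

/-! ## Smooth functions -/

/-- The algebra of smooth functions on space-time. -/
def Smooth (d : ℕ) : Subalgebra ℝ (Space d → ℝ) where
  carrier := {φ | ContDiff ℝ ∞ φ}
  mul_mem' {φ ψ} (h : ContDiff ℝ ∞ φ) (h' : ContDiff ℝ ∞ ψ) := h.mul h'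
  add_mem' {φ ψ} (h : ContDiff ℝ ∞ φ) (h' : ContDiff ℝ ∞ ψ) := h.add h'
  algebraMap_mem' c := (contDiff_const : ContDiff ℝ ∞ fun _ : Space d => c)

theorem Smooth.contDiff {d : ℕ} (φ : Smooth d) : ContDiff ℝ ∞ (φ : Space d → ℝ) := φ.2

theorem partialD_contDiff {d : ℕ} (i : Fin (d + 1)) {φ : Space d → ℝ} (h : ContDiff ℝ ∞ φ) :
    ContDiff ℝ ∞ (partialD i φ) :=
  (h.fderiv_right (m := ∞) (by simp)).clm_apply contDiff_const

/-- The partial derivative as a linear operator on smooth functions. -/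
def partialDₗ {d : ℕ} (i : Fin (d + 1)) : Smooth d →ₗ[ℝ] Smooth d where
  toFun φ := ⟨partialD i φ, partialD_contDiff i φ.2⟩
  map_add' φ ψ := by
    ext x
    have hφ : DifferentiableAt ℝ (φ : Space d → ℝ) x := (Smooth.contDiff φ).differentiable (by simp) x
    have hψ : DifferentiableAt ℝ (ψ : Space d → ℝ) x := (Smooth.contDiff ψ).differentiable (by simp) x
    simp [partialD, fderiv_add hφ hψ]
  map_smul' c φ := by
    ext x
    have hφ : DifferentiableAt ℝ (φ : Space d → ℝ) x := (Smooth.contDiff φ).differentiable (by simp) x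
    simp [partialD, fderiv_const_smul hφ]

/-- The derivative `D^k` as a linear operator on smooth functions. -/
def multiDₗ {d : ℕ} (k : MI d) : Smooth d →ₗ[ℝ] Smooth d :=
  (List.finRange (d + 1)).foldr (fun i T => ((partialDₗ i) ^ (k i)) ∘ₗ T) LinearMap.id

theorem coe_multiDₗ {d : ℕ} (k : MI d) (φ : Smooth d) :
    (multiDₗ k φ : Space d → ℝ) = multiD k φ := by
  unfold multiDₗ multiD
  induction List.finRange (d + 1) with
  | nil => rfl
  | cons i l ih =>
    have key : ∀ (n : ℕ) (ψ : Smooth d),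
        (((partialDₗ i) ^ n) ψ : Space d → ℝ) = (partialD i)^[n] ψ := by
      intro n
      induction n with
      | zero => intro ψ; rfl
      | succ n ihn => intro ψ; rw [pow_succ, Module.End.mul_apply, ihn]; rfl
    simp only [List.foldr_cons, LinearMap.comp_apply, key, ih]

theorem mono_sub_contDiff {d : ℕ} (z : Space d) (n : MI d) :
    ContDiff ℝ ∞ fun y : Space d => mono (y - z) n := by
  unfold mono
  refine contDiff_prod fun i _ => ContDiff.pow ?_ _
  exact (contDiff_apply ℝ ℝ i).comp (contDiff_id.sub contDiff_const)

/-- The centred monomial `(· - z)^n`. -/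
def monomial {d : ℕ} (z : Space d) (n : MI d) : Smooth d :=
  ⟨fun y => mono (y - z) n, mono_sub_contDiff z n⟩

theorem monomial_add {d : ℕ} (z : Space d) (n m : MI d) :
    monomial z (n + m) = monomial z n * monomial z m := by
  ext y
  simp [monomial, mono, pow_add, Finset.prod_mul_distrib]

theorem monomial_zero {d : ℕ} (z : Space d) : monomial z 0 = 1 := by
  ext y
  simp [monomial, mono]

-- Smoothness is local: for `y` near `y₀` only the values of `ψ` on a fixed compact set enter, so
-- `ψ` may be multiplied by a cutoff. Then the factor `χ ψ` is smooth with compact support and all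
-- derivatives fall on it, while `K` need only be locally integrable.
open MeasureTheory in
theorem contDiff_convolution_of_hasCompactSupport_left {d : ℕ} {K ψ : Space d → ℝ}
    (hK : HasCompactSupport K) (hK' : Integrable K) (hψ : ContDiff ℝ ∞ ψ) :
    ContDiff ℝ ∞ fun y => ∫ x, K x * ψ (y - x) := by
  rw [contDiff_iff_contDiffAt]
  intro y₀
  obtain ⟨χ, hχ1, hχ2, hχ3⟩ : ∃ χ : Space d → ℝ, ContDiff ℝ ∞ χ ∧ HasCompactSupport χ ∧
      ∀ y ∈ Metric.ball y₀ 1, ∀ x ∈ tsupport K, χ (y - x) = 1 := by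
    -- The set of all differences `y - x` that occur; the bump equals 1 on a ball of radius `R`
    -- containing it.
    have hc : IsCompact ((fun p : Space d × Space d => p.1 - p.2) ''
        (Metric.closedBall y₀ 1 ×ˢ tsupport K)) :=
      ((isCompact_closedBall y₀ 1).prod hK).image (by fun_prop)
    obtain ⟨R, hR, hsub⟩ := hc.isBounded.subset_closedBall_lt 0 0
    let χ : ContDiffBump (0 : Space d) := ⟨R, R + 1, hR, by linarith⟩
    refine ⟨χ, χ.contDiff, χ.hasCompactSupport, fun y hy x hx => ?_⟩
    exact χ.one_of_mem_closedBall
      (hsub ⟨(y, x), ⟨Metric.ball_subset_closedBall hy, hx⟩, rfl⟩)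
  have h1 : ContDiff ℝ ∞ (convolution K (fun x => χ x * ψ x) (ContinuousLinearMap.mul ℝ ℝ) volume) :=
    HasCompactSupport.contDiff_convolution_right (n := ⊤) _ hχ2.mul_right hK'.locallyIntegrable
      (hχ1.mul hψ)
  refine h1.contDiffAt.congr_of_eventuallyEq ?_
  filter_upwards [Metric.ball_mem_nhds y₀ one_pos] with y hy
  simp only [convolution, ContinuousLinearMap.mul_apply']
  refine integral_congr_ae (Filter.Eventually.of_forall fun x => ?_)
  by_cases hx : x ∈ tsupport K
  · simp [hχ3 y hy x hx]
  · simp [image_eq_zero_of_notMem_tsupport hx]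

/-! ### Kernel convolution and integration as linear operators on smooth functions. -/

namespace Data

variable {N : Type u} {P : Type v} {d : ℕ} (D : Data N P d)

theorem integrable_kernel_mul (t : P) {ψ : Space d → ℝ} (hψ : Continuous ψ) (y : Space d) :
    MeasureTheory.Integrable fun x => D.kernel t x * ψ (y - x) :=
  ((D.kernel_compact t).convolutionExists_left_of_continuous_right
    (ContinuousLinearMap.mul ℝ ℝ) (D.kernel_integrable t).locallyIntegrable hψ) y

/-- Convolution with `D^k K_t` as a linear operator on smooth functions. -/
def kernelConvₗ (t : P) (k : MI d) : Smooth d →ₗ[ℝ] Smooth d where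
  toFun φ := ⟨D.kernelConv t k φ, by
    unfold kernelConv
    rw [← coe_multiDₗ]
    exact contDiff_convolution_of_hasCompactSupport_left (D.kernel_compact t)
      (D.kernel_integrable t) (multiDₗ k φ).2⟩
  map_add' φ ψ := by
    ext y
    have hc : ∀ χ : Smooth d, Continuous (multiDₗ k χ : Space d → ℝ) :=
      fun χ => (Smooth.contDiff (multiDₗ k χ)).continuous
    change D.kernelConv t k _ y = D.kernelConv t k _ y + D.kernelConv t k _ y
    simp only [kernelConv, ← coe_multiDₗ, map_add]
    rw [← MeasureTheory.integral_add (D.integrable_kernel_mul t (hc φ) y)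
      (D.integrable_kernel_mul t (hc ψ) y)]
    simp [mul_add]
  map_smul' c φ := by
    ext y
    change D.kernelConv t k _ y = c * D.kernelConv t k _ y
    simp only [kernelConv, ← coe_multiDₗ, map_smul]
    rw [← MeasureTheory.integral_const_mul]
    simp [mul_left_comm]

/-- Evaluation at a point. -/
def evalAt (z : Space d) : Smooth d →ₗ[ℝ] ℝ := LinearMap.proj z ∘ₗ (Smooth d).val.toLinearMap

/-- The operation `φ ↦ D^k K_t * φ - ∑_ℓ (· - z)^ℓ / ℓ! (D^{k+ℓ} K_t * φ)(z)` that realizes `𝓘^t_k`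
on a tree of homogeneity `α`. -/
def integration (z : Space d) (t : P) (k : MI d) (α : ℝ) : Smooth d →ₗ[ℝ] Smooth d :=
  D.kernelConvₗ t k - ∑ l ∈ D.jets (D.kernelDeg t - D.sdeg k + α),
    (((∏ i, (l i).factorial : ℕ) : ℝ)⁻¹ • evalAt z ∘ₗ D.kernelConvₗ t (k + l)).smulRight
      (monomial z l)

theorem coe_integration (z : Space d) (t : P) (k : MI d) (α : ℝ) (φ : Smooth d) (y : Space d) :
    (D.integration z t k α φ : Space d → ℝ) y = D.kernelConv t k φ y
        - ∑ l ∈ D.jets (D.kernelDeg t - D.sdeg k + α),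
            mono (y - z) l / ((∏ i, (l i).factorial : ℕ) : ℝ)
              * D.kernelConv t (k + l) φ z := by
  simp only [integration, LinearMap.sub_apply, LinearMap.sum_apply, AddSubgroupClass.coe_sub,
    Pi.sub_apply]
  congr 1
  rw [AddSubmonoidClass.coe_finsetSum, Finset.sum_apply]
  refine Finset.sum_congr rfl fun l _ => ?_
  simp only [LinearMap.smulRight_apply, LinearMap.smul_apply, LinearMap.comp_apply, smul_eq_mul,
    Subalgebra.coe_smul, Pi.smul_apply]
  change _ * D.kernelConv t (k + l) φ z * mono (y - z) l = _
  ring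

end Data

/-! ## Trees in exploded form -/

theorem ODec.map_zero {L : Type u} {L' : Type v} {d : ℕ} (φ : L → L') :
    ODec.map φ (0 : ODec L d) = 0 := by
  simp [ODec.map]

theorem ODec.map_add {L : Type u} {L' : Type v} {d : ℕ} (φ : L → L') (o o' : ODec L d) :
    ODec.map φ (o + o') = ODec.map φ o + ODec.map φ o' := by
  simp [ODec.map, Finsupp.mapDomain_add]

theorem ODec.map_map {L : Type u} {L' : Type v} {L'' : Type w} {d : ℕ} (φ : L → L') (ψ : L' → L'')
    (o : ODec L d) : (o.map φ).map ψ = o.map (ψ ∘ φ) := by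
  simp [ODec.map, Finsupp.mapDomain_comp]

theorem ODec.map_id {L : Type u} {d : ℕ} (o : ODec L d) : o.map id = o := by
  simp [ODec.map, Finsupp.mapDomain_id]

theorem PTree.map_map {L : Type u} {L' : Type v} {L'' : Type w} {d : ℕ} (φ : L → L') (ψ : L' → L'')
    (τ : PTree L d) : (τ.map φ).map ψ = τ.map (ψ ∘ φ) := by
  induction τ with
  | root n o => simp [PTree.map, ODec.map_map]
  | graft t k σ τ ih ih' => simp [PTree.map, ih, ih']

theorem PTree.map_id {L : Type u} {d : ℕ} (τ : PTree L d) : τ.map id = τ := by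
  induction τ with
  | root n o => simp [PTree.map, ODec.map_id]
  | graft t k σ τ ih ih' => simp [PTree.map, ih, ih']

theorem PTree.nodeType_map {L : Type u} {L' : Type v} {d : ℕ} (φ : L → L') (τ : PTree L d) :
    (τ.map φ).nodeType = τ.nodeType.map fun x => (φ x.1, x.2) := by
  induction τ with
  | root n o => rfl
  | graft t k σ τ _ ih => simp [PTree.map, PTree.nodeType, ih]

/-- All edge types of the tree satisfy `p`. -/
def PTree.AllEdges {L : Type u} {d : ℕ} (p : L → Prop) : PTree L d → Prop
  | .root _ _ => True
  | .graft t _ σ τ => p t ∧ PTree.AllEdges p σ ∧ PTree.AllEdges p τ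

theorem PTree.Iso.allEdges_eq {L : Type u} {d : ℕ} (p : L → Prop) {σ τ : PTree L d}
    (h : PTree.Iso σ τ) : σ.AllEdges p = τ.AllEdges p :=
  h.map_eq _ (fun _ _ _ _ _ _ h h' _ => by simp [PTree.AllEdges, h, h'])
    (fun _ _ _ _ _ _ _ => by simp only [PTree.AllEdges, eq_iff_iff]; tauto)

theorem PTree.allEdges_map {L : Type u} {L' : Type v} {d : ℕ} (p : L' → Prop) (φ : L → L')
    (hφ : ∀ t, p (φ t)) (τ : PTree L d) : (τ.map φ).AllEdges p := by
  induction τ with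
  | root n o => trivial
  | graft t k σ τ ih ih' => exact ⟨hφ t, ih, ih'⟩

namespace Tree

variable {L : Type u} {d : ℕ}

/-- All edge types of the tree satisfy `p`. -/
def AllEdges (p : L → Prop) : Tree L d → Prop :=
  Quotient.lift (PTree.AllEdges p) fun _ _ h => PTree.Iso.allEdges_eq p h

theorem allEdges_graft (p : L → Prop) (t : L) (k : MI d) (σ τ : Tree L d) :
    (graft t k σ τ).AllEdges p ↔ p t ∧ σ.AllEdges p ∧ τ.AllEdges p := by
  induction σ using Quotient.inductionOn
  induction τ using Quotient.inductionOn
  rfl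

theorem allEdges_map {L' : Type v} (p : L' → Prop) (φ : L → L')
    (hφ : ∀ t, p (φ t)) (τ : Tree L d) : (τ.map φ).AllEdges p := by
  induction τ using Quotient.inductionOn
  exact PTree.allEdges_map p φ hφ _

theorem map_map {L' : Type v} {L'' : Type w} (φ : L → L') (ψ : L' → L'')
    (τ : Tree L d) : (τ.map φ).map ψ = τ.map (ψ ∘ φ) := by
  induction τ using Quotient.inductionOn with
  | h τ => exact congrArg (Quotient.mk _) (PTree.map_map φ ψ τ)

theorem map_id (τ : Tree L d) : τ.map id = τ := by
  induction τ using Quotient.inductionOn with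
  | h τ => exact congrArg (Quotient.mk _) (PTree.map_id τ)

theorem map_graft {L' : Type v} (φ : L → L') (t : L) (k : MI d) (σ τ : Tree L d) :
    (graft t k σ τ).map φ = graft (φ t) k (σ.map φ) (τ.map φ) := by
  induction σ using Quotient.inductionOn
  induction τ using Quotient.inductionOn
  rfl

theorem map_injective {L' : Type v} {φ : L → L'} {ψ : L' → L} (h : Function.LeftInverse ψ φ) :
    Function.Injective (Tree.map φ : Tree L d → Tree L' d) := by
  intro σ τ hστ
  have := congrArg (Tree.map ψ) hστ
  rwa [map_map, map_map, h.comp_eq_id, map_id, map_id] at this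

theorem assemble_root (n : MI d) (o : ODec L d) : assemble (n, o, 0) = root n o := rfl

theorem assemble_zero : assemble (0 : Exploded L d) = root 0 0 := rfl

theorem assemble_cons (n : MI d) (o : ODec L d) (b : L × MI d × Tree L d) (B : Branches L d) :
    assemble (n, o, b ::ₘ B) = graft b.1 b.2.1 b.2.2 (assemble (n, o, B)) :=
  Multiset.foldr_cons _ _ _ _

theorem allEdges_assemble (p : L → Prop) (x : Exploded L d) :
    (assemble x).AllEdges p ↔ ∀ b ∈ x.2.2, p b.1 ∧ b.2.2.AllEdges p := by
  obtain ⟨n, o, B⟩ := x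
  induction B using Multiset.induction_on with
  | empty => exact ⟨fun _ _ h => absurd h (Multiset.notMem_zero _), fun _ => trivial⟩
  | cons b B ih =>
    rw [assemble_cons, allEdges_graft, ih]
    simp [and_assoc]

theorem allEdges_assemble_add (p : L → Prop) (x y : Exploded L d) :
    (assemble (x + y)).AllEdges p ↔ (assemble x).AllEdges p ∧ (assemble y).AllEdges p := by
  simp only [allEdges_assemble, Prod.snd_add, Multiset.mem_add, or_imp, forall_and]
  tauto

/-- Change of types for trees in exploded form. -/
def explodedMap {L' : Type v} (φ : L → L') : Exploded L d →+ Exploded L' d where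
  toFun x := (x.1, x.2.1.map φ, x.2.2.map fun b => (φ b.1, b.2.1, b.2.2.map φ))
  map_zero' := by simp [ODec.map_zero]
  map_add' x y := by simp [ODec.map_add]

theorem assemble_explodedMap {L' : Type v} (φ : L → L') (x : Exploded L d) :
    assemble (explodedMap φ x) = (assemble x).map φ := by
  obtain ⟨n, o, B⟩ := x
  induction B using Multiset.induction_on with
  | empty => rfl
  | cons b B ih =>
    rw [assemble_cons, map_graft, ← ih]
    simp [explodedMap, assemble_cons]

end Tree

/-! ## Homogeneity and canonical lift of trees in exploded form -/

namespace Data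

variable {N : Type u} {P : Type v} {d : ℕ} (D : Data N P d)

theorem sdeg_add (n m : MI d) : D.sdeg (n + m) = D.sdeg n + D.sdeg m := by
  simp [sdeg, mul_add, Finset.sum_add_distrib]

theorem sdeg_zero : D.sdeg (0 : MI d) = 0 := by simp [sdeg]

theorem odeg_add (o o' : ODec (N ⊕ P) d) : D.odeg (o + o') = D.odeg o + D.odeg o' := by
  simp only [odeg, Prod.fst_add, Prod.snd_add, Pi.add_apply, Int.cast_add, mul_add,
    Finset.sum_add_distrib]
  rw [Finsupp.sum_add_index' (by simp) (by intros; push_cast; ring)]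
  ring

theorem odeg_zero : D.odeg 0 = 0 := by simp [odeg]

theorem odeg_polyO (m : MI d) : D.odeg (polyO m) = D.sdeg m := by
  simp [odeg, polyO, sdeg]

theorem odeg_edgeO (t : N ⊕ P) (k : MI d) : D.odeg (edgeO t k) = D.tdeg t - D.sdeg k := by
  simp [odeg, edgeO, sdeg, Finsupp.sum_single_index]
  ring

/-- The homogeneity `|τ|_+` of a tree. -/
def degPlus : Tree (N ⊕ P) d → ℝ :=
  Quotient.lift (PTree.degPlus D) fun _ _ h => PTree.Iso.degPlus_eq D h

theorem degPlus_graft (t : N ⊕ P) (k : MI d) (σ τ : Tree (N ⊕ P) d) :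
    D.degPlus (Tree.graft t k σ τ) = (D.tdeg t - D.sdeg k) + D.degPlus σ + D.degPlus τ := by
  induction σ using Quotient.inductionOn
  induction τ using Quotient.inductionOn
  rfl

/-- The right-hand side is visibly additive in `x`. Together with the product formula
`smoothModel_assemble` this makes homogeneity and lift compatible with the tree product, which is
what turns `pairValue` into a monoid homomorphism. -/
theorem degPlus_assemble (x : Tree.Exploded (N ⊕ P) d) :
    D.degPlus (Tree.assemble x) = D.sdeg x.1 + D.odeg x.2.1 +
      (x.2.2.map fun b => (D.tdeg b.1 - D.sdeg b.2.1) + D.degPlus b.2.2).sum := by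
  obtain ⟨n, o, B⟩ := x
  induction B using Multiset.induction_on with
  | empty => simp [Tree.assemble_root, Tree.root, degPlus, PTree.degPlus]
  | cons b B ih =>
    rw [Tree.assemble_cons, degPlus_graft, ih]
    simp
    ring

theorem degPlus_assemble_zero : D.degPlus (Tree.assemble 0) = 0 := by
  simp [degPlus_assemble, sdeg_zero, odeg_zero]

theorem degPlus_assemble_add (x y : Tree.Exploded (N ⊕ P) d) :
    D.degPlus (Tree.assemble (x + y)) =
      D.degPlus (Tree.assemble x) + D.degPlus (Tree.assemble y) := by
  simp [degPlus_assemble, sdeg_add, odeg_add]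
  ring

theorem modelPTree_contDiff (ξ : N → Smooth d) (z : Space d) (τ : PTree (N ⊕ P) d) :
    ContDiff ℝ ∞ (D.modelPTree (fun t => ξ t) z τ) := by
  induction τ with
  | root n o => exact mono_sub_contDiff z n
  | graft t k σ τ ih ih' =>
    rcases t with t | t
    · simp only [modelPTree, ← coe_multiDₗ]
      exact (Smooth.contDiff (multiDₗ k (ξ t))).mul ih'
    -- The bracket in the definition of the lift is `integration` applied to the lift of the branch,
    -- which is smooth by induction.
    · have := fun y => D.coe_integration z t k (σ.degPlus D) ⟨_, ih⟩ y
      simp only [modelPTree, ← this]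
      exact (Smooth.contDiff (D.integration z t k _ _)).mul ih'

/-- The canonical lift of smooth noises on a tree. -/
def smoothModel (ξ : N → Smooth d) (z : Space d) : Tree (N ⊕ P) d → Smooth d :=
  Quotient.lift (fun τ => ⟨D.modelPTree (fun t => ξ t) z τ, D.modelPTree_contDiff ξ z τ⟩)
    fun _ _ h => Subtype.ext (D.modelPTree_eq _ z h)

theorem model_single (ξ : N → Smooth d) (z : Space d) (τ : Tree (N ⊕ P) d) (c : ℝ) :
    D.model (fun t => ξ t) z (Finsupp.single τ c) = c • (D.smoothModel ξ z τ : Space d → ℝ) := by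
  induction τ using Quotient.inductionOn
  exact Finsupp.linearCombination_single ℝ _ _

/-- The canonical lift on a branch. -/
def branchModel (ξ : N → Smooth d) (z : Space d) : (N ⊕ P) × MI d × Tree (N ⊕ P) d → Smooth d
  | (.inl t, k, _) => multiDₗ k (ξ t)
  | (.inr t, k, σ) => D.integration z t k (D.degPlus σ) (D.smoothModel ξ z σ)

theorem smoothModel_graft (ξ : N → Smooth d) (z : Space d) (t : N ⊕ P) (k : MI d)
    (σ τ : Tree (N ⊕ P) d) : D.smoothModel ξ z (Tree.graft t k σ τ) =
      D.branchModel ξ z (t, k, σ) * D.smoothModel ξ z τ := by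
  induction σ using Quotient.inductionOn
  induction τ using Quotient.inductionOn
  ext y
  rcases t with t | t
  · change multiD k (ξ t) y * _ = (multiDₗ k (ξ t) : Space d → ℝ) y * _
    rw [coe_multiDₗ]
    rfl
  · change _ = (D.integration z t k _ _ : Space d → ℝ) y * _
    rw [coe_integration]
    rfl

theorem smoothModel_assemble (ξ : N → Smooth d) (z : Space d) (x : Tree.Exploded (N ⊕ P) d) :
    D.smoothModel ξ z (Tree.assemble x) =
      monomial z x.1 * (x.2.2.map (D.branchModel ξ z)).prod := by
  obtain ⟨n, o, B⟩ := x
  induction B using Multiset.induction_on with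
  | empty =>
    simp only [Multiset.map_zero, Multiset.prod_zero, mul_one]
    rfl
  | cons b B ih =>
    rw [Tree.assemble_cons, smoothModel_graft, ih]
    simp [mul_left_comm]

theorem smoothModel_assemble_zero (ξ : N → Smooth d) (z : Space d) :
    D.smoothModel ξ z (Tree.assemble 0) = 1 := by
  simp [smoothModel_assemble, monomial_zero]

theorem smoothModel_assemble_add (ξ : N → Smooth d) (z : Space d)
    (x y : Tree.Exploded (N ⊕ P) d) : D.smoothModel ξ z (Tree.assemble (x + y)) =
      D.smoothModel ξ z (Tree.assemble x) * D.smoothModel ξ z (Tree.assemble y) := by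
  simp only [smoothModel_assemble, Prod.fst_add, Prod.snd_add, monomial_add, Multiset.map_add,
    Multiset.prod_add]
  ring

end Data

/-! ## Characters on extensions -/

section Types

variable {N : Type u} {P : Type v} {d : ℕ} {I J : Type}

/-- Change of the indices of the types in `N × I`. -/
def reindex (ρ : I → J) : ExtTypes N P I → ExtTypes N P J :=
  Sum.map (Sum.map id (Prod.map id ρ)) id

theorem reindex_comp_embed (ρ : I → J) :
    (reindex ρ : ExtTypes N P I → ExtTypes N P J) ∘ embed = embed := by
  funext t
  rcases t with t | t <;> rfl

theorem reindex_leftInverse {ρ : I → J} {ρ' : J → I} (h : Function.LeftInverse ρ' ρ) :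
    Function.LeftInverse (reindex ρ' : ExtTypes N P J → ExtTypes N P I) (reindex ρ) := by
  rintro ((t | t) | t)
  · rfl
  · simp [reindex, Prod.map, h t.2]
  · rfl

theorem reindex_comp_setIdx {I' : Type} (ρ : I → J) (i : I) :
    (reindex ρ : ExtTypes N P I → ExtTypes N P J) ∘ (setIdx i : ExtTypes N P I' → _) =
      setIdx (ρ i) := by
  funext t
  rcases t with (t | t) | t <;> rfl

theorem forget_setIdx (j : J) (t : ExtTypes N P I) : forget (setIdx j t) = forget t := by
  rcases t with (t | t) | t <;> rfl

theorem forget_embed (t : N ⊕ P) : forget (embed t : ExtTypes N P I) = t := by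
  rcases t with t | t <;> rfl

theorem not_isHat_embed (t : N ⊕ P) : ¬ IsHat (embed t : ExtTypes N P I) := by
  rcases t with t | t <;> simp [IsHat, embed]

end Types

namespace Data

variable {N : Type u} {P : Type v} {d : ℕ} (D : Data N P d) {I : Type}

theorem tdeg_ext (t : ExtTypes N P I) : (D.ext I).tdeg t = D.tdeg (forget t) := by
  rcases t with (t | t) | t <;> rfl

/-- The homogeneity of an extended type depends only on its image under `forget`. -/
theorem odeg_ext_map {L : Type} (φ : ExtTypes N P L → ExtTypes N P I)
    (hφ : ∀ t, forget (φ t) = forget t) (o : ODec (ExtTypes N P L) d) :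
    (D.ext I).odeg (o.map φ) = (D.ext L).odeg o := by
  simp only [odeg, ODec.map]
  rw [Finsupp.sum_mapDomain_index (by simp) (by intros; push_cast; ring)]
  simp only [tdeg_ext, hφ]
  rfl

theorem degMinus_embed (τ : Tree (N ⊕ P) d) :
    (D.ext I).degMinus (τ.map embed) = D.degMinus τ := by
  induction τ using Quotient.inductionOn with
  | h τ =>
    change (τ.map embed).degMinus (D.ext I) = τ.degMinus D
    induction τ with
    | root n o => rfl
    | graft t k σ τ ih ih' =>
      simp only [PTree.map, PTree.degMinus, ih, ih', tdeg_ext, forget_embed]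
      rfl

theorem conforms_embed {τ : PTree (N ⊕ P) d} (h : τ.Conforms D) :
    (τ.map embed).Conforms (D.ext I) := by
  induction τ with
  | root n o => trivial
  | graft t k σ τ ih ih' =>
    rcases t with t | t
    · obtain ⟨h1, h2⟩ := h
      have h1 : σ = .root 0 0 := h1
      subst h1
      exact ⟨by simp [embed, PTree.map, ODec.map_zero], ih' h2⟩
    · obtain ⟨⟨h0, h1⟩, h2⟩ := h
      refine ⟨⟨?_, ih h1⟩, ih' h2⟩
      simpa [ext, PTree.nodeType_map, forget_embed] using h0

theorem embed_mem_trees {τ : Tree (N ⊕ P) d} (h : τ ∈ D.trees) :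
    τ.map embed ∈ (D.ext I).trees := by
  induction τ using Quotient.inductionOn with
  | h τ =>
    obtain ⟨h, t, ht⟩ := h
    refine ⟨D.conforms_embed h, ?_⟩
    rcases t with t | t
    · refine ⟨.inl (.inl t), ?_⟩
      rw [D.rule_noise, Set.mem_singleton_iff] at ht
      simp [ext, PTree.nodeType_map, ht]
    · exact ⟨.inr t, by simpa [ext, PTree.nodeType_map, forget_embed] using ht⟩

/-- The value of a character of `𝓣_-^ex` on trees of the extension, zero on trees that do not come
from `𝓣_-^ex`. -/
def treeValue (g : D.TMinus →ₐ[ℝ] ℝ) : Tree (ExtTypes N P I) d → ℝ :=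
  Function.extend (fun σ : D.NegTree => Tree.map embed σ.1) (fun σ => g (MvPolynomial.X σ)) 0

theorem map_embed_injective :
    Function.Injective (Tree.map embed : Tree (N ⊕ P) d → Tree (ExtTypes N P I) d) :=
  Tree.map_injective (ψ := forget) forget_embed

theorem treeValue_embed (g : D.TMinus →ₐ[ℝ] ℝ) (σ : D.NegTree) :
    D.treeValue (I := I) g (σ.1.map embed) = g (MvPolynomial.X σ) :=
  Function.Injective.extend_apply (fun _ _ h => Subtype.ext (map_embed_injective h)) _ _ σ

theorem treeValue_eq_zero (g : D.TMinus →ₐ[ℝ] ℝ) {τ : Tree (ExtTypes N P I) d}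
    (h : ∀ σ : D.NegTree, σ.1.map embed ≠ τ) : D.treeValue g τ = 0 :=
  Function.extend_apply' _ _ _ fun ⟨σ, hσ⟩ => h σ hσ

/-- The membership test in `component` becomes superfluous: a tree failing it is not the image of a
negative tree of `𝓣^ex`, since `embed` preserves conformity and homogeneity, so `treeValue` vanishes
there anyway. -/
theorem extendChar_component (g : D.TMinus →ₐ[ℝ] ℝ) (C : Tree.Exploded (ExtTypes N P I) d) :
    D.extendChar g I ((D.ext I).component C) =
      open Classical in
      if C.2.2 = 0 then (if C.1 = 0 then 1 else 0) else D.treeValue g (Tree.assemble C) := by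
  classical
  unfold component
  split_ifs with h1 h2 h3
  · simp
  · simp
  · exact MvPolynomial.aeval_X _ _
  · rw [map_zero, treeValue_eq_zero]
    intro σ hσ
    refine h3 ?_
    rw [← hσ, degMinus_embed]
    exact ⟨D.embed_mem_trees σ.2.1, σ.2.2⟩

/-- Reindexing fixes all trees coming from `𝓣_-^ex`, and by the left inverse no other tree is mapped
onto one of them. -/
theorem treeValue_reindex (g : D.TMinus →ₐ[ℝ] ℝ) {J : Type} {ρ : I → J} {ρ' : J → I}
    (h : Function.LeftInverse ρ' ρ) (τ : Tree (ExtTypes N P I) d) :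
    D.treeValue g (τ.map (reindex ρ)) = D.treeValue g τ := by
  by_cases hτ : ∃ σ : D.NegTree, σ.1.map embed = τ
  · obtain ⟨σ, rfl⟩ := hτ
    rw [Tree.map_map, reindex_comp_embed, treeValue_embed, treeValue_embed]
  · rw [treeValue_eq_zero _ _ (not_exists.1 hτ), treeValue_eq_zero]
    intro σ hσ
    refine hτ ⟨σ, Tree.map_injective (reindex_leftInverse h) ?_⟩
    rw [Tree.map_map, reindex_comp_embed, hσ]

theorem extendChar_component_reindex (g : D.TMinus →ₐ[ℝ] ℝ) {J : Type} {ρ : I → J} {ρ' : J → I}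
    (h : Function.LeftInverse ρ' ρ) (C : Tree.Exploded (ExtTypes N P I) d) :
    D.extendChar g J ((D.ext J).component (Tree.explodedMap (reindex ρ) C)) =
      D.extendChar g I ((D.ext I).component C) := by
  rw [extendChar_component, extendChar_component, Tree.assemble_explodedMap,
    D.treeValue_reindex g h]
  have h0 : (Tree.explodedMap (reindex ρ) C).2.2 = 0 ↔ C.2.2 = 0 := Multiset.map_eq_zero
  by_cases hC : C.2.2 = 0
  · rw [if_pos hC, if_pos (h0.2 hC)]
    rfl
  · rw [if_neg hC, if_neg (h0.not.2 hC)]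

/-- There are no edges with types in `N × I`. -/
def HatFree (C : Tree.Exploded (ExtTypes N P I) d) : Prop :=
  (Tree.assemble C).AllEdges fun t => ¬ IsHat t

/-- Trees in the image of `embed` have no edge with type in `N × I`. This is the mechanism by which
edges of `L̂` are never extracted. -/
theorem extendChar_component_eq_zero (g : D.TMinus →ₐ[ℝ] ℝ)
    {C : Tree.Exploded (ExtTypes N P I) d} (h : ¬ HatFree C) :
    D.extendChar g I ((D.ext I).component C) = 0 := by
  rw [extendChar_component, if_neg, treeValue_eq_zero]
  · intro σ hσ
    refine h ?_
    rw [HatFree, ← hσ]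
    exact Tree.allEdges_map (fun t => ¬ IsHat t) embed not_isHat_embed σ.1
  · intro h0
    refine h ?_
    rw [HatFree, Tree.allEdges_assemble, h0]
    exact fun _ hb => absurd hb (Multiset.notMem_zero _)

end Data

/-! ## Evaluation of cuts -/

section AddMonoidAlgebra

theorem addMonoidAlgebra_sum_add {R X M : Type*} [Semiring R] [AddCommMonoid M]
    (F : X → R →+ M) (S T : AddMonoidAlgebra R X) :
    (S + T).coeff.sum (fun x p => F x p) =
      S.coeff.sum (fun x p => F x p) + T.coeff.sum (fun x p => F x p) := by
  rw [AddMonoidAlgebra.coeff_add]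
  exact Finsupp.sum_add_index' (fun x => map_zero (F x)) (fun x => map_add (F x))

/-- The additive map on formal sums with given values on single terms. -/
def sumHom {R X M : Type*} [Semiring R] [AddCommMonoid M] (F : X → R →+ M) :
    AddMonoidAlgebra R X →+ M where
  toFun S := S.coeff.sum fun x p => F x p
  map_zero' := Finsupp.sum_zero_index
  map_add' := addMonoidAlgebra_sum_add F

theorem sumHom_single {R X M : Type*} [Semiring R] [AddCommMonoid M] (F : X → R →+ M) (x : X)
    (p : R) : sumHom F (AddMonoidAlgebra.single x p) = F x p :=
  Finsupp.sum_single_index (map_zero (F x))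

end AddMonoidAlgebra

namespace Data

variable {N : Type u} {P : Type v} {d : ℕ} (D : Data N P d) {I : Type}

/-- Additivity allows identities about `cutEdge` to be checked on single terms. -/
theorem cutEdge_add (b : ℕ) (t : N ⊕ P) (k : MI d) (S T : D.Cuts) :
    D.cutEdge b t k (S + T) = D.cutEdge b t k S + D.cutEdge b t k T := by
  unfold cutEdge
  rw [AddMonoidAlgebra.coeff_add]
  refine Finsupp.sum_add_index' (fun x => by simp) fun x p q => ?_
  simp only [mul_add, AddMonoidAlgebra.single_add, Finset.sum_add_distrib]
  abel

theorem cutEdge_single (b : ℕ) (t : N ⊕ P) (k : MI d)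
    (x : Tree.Exploded (N ⊕ P) d × Tree.Exploded (N ⊕ P) d) (p : D.TMinus) :
    D.cutEdge b t k (AddMonoidAlgebra.single x p) =
      AddMonoidAlgebra.single
        ((0, 0, {(t, k, Tree.assemble x.1)}), (x.2.1, x.2.2.1 + edgeO t k, x.2.2.2)) p
      + ∑ ε ∈ Finset.Iic (fun _ => b : MI d), AddMonoidAlgebra.single
        (((ε, 0, 0), (0, polyO ε, {(t, k + ε, Tree.assemble x.2)})) :
          Tree.Exploded (N ⊕ P) d × Tree.Exploded (N ⊕ P) d)
        (MvPolynomial.C ((∏ i, (ε i).factorial : ℕ) : ℝ)⁻¹ * D.component x.1 * p) :=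
  Finsupp.sum_single_index (by simp)

end Data

/-- Formal sums of exploded trees with a homogeneity, with smooth functions as coefficients: the
values of the formal sums over subforests when the contracted trees are replaced by their canonical
lifts. -/
abbrev Values (L : Type u) (d : ℕ) : Type u :=
  AddMonoidAlgebra (Smooth d) (Tree.Exploded L d × ℝ)

namespace Data

variable {N : Type u} {P : Type v} {d : ℕ} (D : Data N P d) {I J : Type}

theorem hatFree_zero : HatFree (0 : Tree.Exploded (ExtTypes N P I) d) := by
  rw [HatFree, Tree.allEdges_assemble]
  exact fun _ hb => absurd hb (Multiset.notMem_zero _)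

theorem hatFree_add (x y : Tree.Exploded (ExtTypes N P I) d) :
    HatFree (x + y) ↔ HatFree x ∧ HatFree y :=
  Tree.allEdges_assemble_add _ _ _

theorem hatFree_node (n : MI d) (o : ODec (ExtTypes N P I) d) : HatFree (n, o, 0) := by
  rw [HatFree, Tree.allEdges_assemble]
  exact fun _ hb => absurd hb (Multiset.notMem_zero _)

theorem hatFree_edge (n : MI d) (o : ODec (ExtTypes N P I) d) (t : ExtTypes N P I) (k : MI d)
    (C : Tree.Exploded (ExtTypes N P I) d) :
    HatFree (n, o, {(t, k, Tree.assemble C)}) ↔ ¬ IsHat t ∧ HatFree C := by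
  rw [HatFree, Tree.allEdges_assemble]
  simp [HatFree]

open Classical in
/-- The value of a pair of exploded trees: the types of the first one are reindexed, the second one
is replaced by its homogeneity and its canonical lift. The value is zero if the first one has edges
with types in `N × I`. -/
def pairValue (ξ : N ⊕ N × I → Smooth d) (z : Space d) (ρ : I → J) :
    Multiplicative (Tree.Exploded (ExtTypes N P I) d × Tree.Exploded (ExtTypes N P I) d) →*
      Values (ExtTypes N P J) d where
  toFun x := if HatFree x.toAdd.1 then
      AddMonoidAlgebra.single
        (Tree.explodedMap (reindex ρ) x.toAdd.1, (D.ext I).degPlus (Tree.assemble x.toAdd.2))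
        ((D.ext I).smoothModel ξ z (Tree.assemble x.toAdd.2))
    else 0
  map_one' := by
    simp [hatFree_zero, degPlus_assemble_zero, smoothModel_assemble_zero,
      AddMonoidAlgebra.one_def]
    rfl
  map_mul' x y := by
    simp only [toAdd_mul, Prod.fst_add, Prod.snd_add, hatFree_add, map_add, degPlus_assemble_add,
      smoothModel_assemble_add]
    by_cases hx : HatFree x.toAdd.1 <;> by_cases hy : HatFree y.toAdd.1 <;>
      simp [hx, hy, AddMonoidAlgebra.single_mul_single]

/-- The value of a formal sum over subforests. -/
def cutsValue (g : D.TMinus →ₐ[ℝ] ℝ) (ξ : N ⊕ N × I → Smooth d) (z : Space d) (ρ : I → J) :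
    (D.ext I).Cuts →+* Values (ExtTypes N P J) d :=
  AddMonoidAlgebra.liftNCRingHom
    ((algebraMap ℝ (Values (ExtTypes N P J) d)).comp (D.extendChar g I : (D.ext I).TMinus →+* ℝ))
    (D.pairValue ξ z ρ) fun _ _ => Commute.all _ _

section

variable (g : D.TMinus →ₐ[ℝ] ℝ) (ξ : N ⊕ N × I → Smooth d) (z : Space d) (ρ : I → J)

open Classical in
theorem cutsValue_single
    (x : Tree.Exploded (ExtTypes N P I) d × Tree.Exploded (ExtTypes N P I) d)
    (p : (D.ext I).TMinus) : D.cutsValue g ξ z ρ (AddMonoidAlgebra.single x p) =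
      if HatFree x.1 then AddMonoidAlgebra.single
        (Tree.explodedMap (reindex ρ) x.1, (D.ext I).degPlus (Tree.assemble x.2))
        (D.extendChar g I p • (D.ext I).smoothModel ξ z (Tree.assemble x.2)) else 0 := by
  rw [cutsValue, AddMonoidAlgebra.liftNCRingHom_single]
  have : ∀ (c : ℝ) (y : Values (ExtTypes N P J) d),
      algebraMap ℝ (Values (ExtTypes N P J) d) c * y = c • y := fun c y => (Algebra.smul_def c y).symm
  simp only [RingHom.comp_apply, this]
  simp only [pairValue, MonoidHom.coe_mk, OneHom.coe_mk, toAdd_ofAdd, smul_ite, smul_zero,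
    AddMonoidAlgebra.smul_single]
  rfl

theorem cutsValue_single_of_hatFree
    {x : Tree.Exploded (ExtTypes N P I) d × Tree.Exploded (ExtTypes N P I) d} (h : HatFree x.1)
    (p : (D.ext I).TMinus) : D.cutsValue g ξ z ρ (AddMonoidAlgebra.single x p) =
      AddMonoidAlgebra.single
        (Tree.explodedMap (reindex ρ) x.1, (D.ext I).degPlus (Tree.assemble x.2))
        (D.extendChar g I p • (D.ext I).smoothModel ξ z (Tree.assemble x.2)) := by
  rw [cutsValue_single, if_pos h]

theorem cutsValue_single_of_not_hatFree
    {x : Tree.Exploded (ExtTypes N P I) d × Tree.Exploded (ExtTypes N P I) d} (h : ¬ HatFree x.1)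
    (p : (D.ext I).TMinus) : D.cutsValue g ξ z ρ (AddMonoidAlgebra.single x p) = 0 := by
  rw [cutsValue_single, if_neg h]

/-- The character applied to a component. -/
def componentValue (C : Tree.Exploded (ExtTypes N P J) d) : ℝ :=
  D.extendChar g J ((D.ext J).component C)

/-- Pairing of formal sums with the character. -/
def pairing : Values (ExtTypes N P J) d →+ (Space d → ℝ) :=
  sumHom fun c => (AddMonoidHom.mulLeft (fun _ => D.componentValue g c.1)).comp
    (Smooth d).val.toLinearMap.toAddMonoidHom

theorem pairing_single (c : Tree.Exploded (ExtTypes N P J) d × ℝ) (φ : Smooth d) :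
    D.pairing g (AddMonoidAlgebra.single c φ) = D.componentValue g c.1 • (φ : Space d → ℝ) :=
  sumHom_single _ _ _

variable {ρ}

/-- Both sides are additive in the formal sum of cuts, so single terms suffice. If the root
component contains an edge with type in `N × I`, the left side vanishes by the choice of the
extended character and the right side by the definition of `pairValue`; otherwise reindexing does
not change the character. -/
theorem model_renorm {ρ' : J → I} (hρ : Function.LeftInverse ρ' ρ)
    (τ : PTree (ExtTypes N P I) d) :
    (D.ext I).model (fun t => ξ t) z ((D.ext I).renorm (D.extendChar g I)
        (Finsupp.single (Quotient.mk _ τ) (1 : ℝ))) =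
      D.pairing g (D.cutsValue g ξ z ρ ((D.ext I).cuts ((D.ext I).epsBound τ) τ)) := by
  have h1 : (D.ext I).coprod (Finsupp.single (Quotient.mk _ τ) (1 : ℝ)) =
      (D.ext I).coprodPTree τ := by
    rw [coprod]
    exact (Finsupp.linearCombination_single ℝ _ _).trans (one_smul _ _)
  simp only [renorm, LinearMap.comp_apply, h1, coprodPTree]
  generalize (D.ext I).cuts ((D.ext I).epsBound τ) τ = S
  rw [map_finsuppSum, map_finsuppSum, map_finsuppSum]
  have h2 : ∀ (x : Tree.Exploded (ExtTypes N P I) d × Tree.Exploded (ExtTypes N P I) d)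
      (p : (D.ext I).TMinus),
      (D.ext I).model (fun t => ξ t) z ((TensorProduct.lid ℝ (D.ext I).Span).toLinearMap
        (LinearMap.rTensor (D.ext I).Span (D.extendChar g I).toLinearMap
          (((D.ext I).component x.1 * p) ⊗ₜ[ℝ] Finsupp.single (Tree.assemble x.2) (1 : ℝ)))) =
      D.pairing g (D.cutsValue g ξ z ρ (AddMonoidAlgebra.single x p)) := by
    intro x p
    rw [LinearMap.rTensor_tmul]
    simp only [AlgHom.toLinearMap_apply, map_mul, LinearEquiv.coe_coe, TensorProduct.lid_tmul,
      map_smul, model_single, one_smul]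
    by_cases hx : HatFree x.1
    · rw [cutsValue_single_of_hatFree _ _ _ _ _ hx, pairing_single, componentValue,
        D.extendChar_component_reindex g hρ]
      rw [Subalgebra.coe_smul, smul_smul]
    · rw [cutsValue_single_of_not_hatFree _ _ _ _ _ hx, D.extendChar_component_eq_zero g hx]
      simp
  simp only [h2]
  -- Termwise evaluation followed by summation is an additive map that agrees with `pairing ∘
  -- cutsValue` on single terms, hence everywhere.
  exact DFunLike.congr_fun (AddMonoidAlgebra.addMonoidHom_ext
    (f := sumHom fun x => ((D.pairing g).comp (D.cutsValue g ξ z ρ).toAddMonoidHom).comp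
      (AddMonoidAlgebra.singleAddHom x))
    (g := (D.pairing g).comp (D.cutsValue g ξ z ρ).toAddMonoidHom)
    fun x p => sumHom_single _ _ _) S

end

end Data

/-! ## Expansion of the canonical lift over subforests -/

namespace PTree

variable {L : Type u} {d : ℕ} {t : L} {k : MI d} {σ τ : PTree L d}

/-- The edge that connects `σ` with `τ` in `graft t k σ τ`. -/
def newEdge (t : L) (k : MI d) (σ τ : PTree L d) : (PTree.graft t k σ τ).Edge :=
  (none : Option (σ.Edge ⊕ τ.Edge))

/-- An edge of `σ` as an edge of `graft t k σ τ`. -/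
def branchEdge (t : L) (k : MI d) (σ τ : PTree L d) (e : σ.Edge) : (PTree.graft t k σ τ).Edge :=
  (some (Sum.inl e) : Option (σ.Edge ⊕ τ.Edge))

/-- An edge of `τ` as an edge of `graft t k σ τ`. -/
def trunkEdge (t : L) (k : MI d) (σ τ : PTree L d) (e : τ.Edge) : (PTree.graft t k σ τ).Edge :=
  (some (Sum.inr e) : Option (σ.Edge ⊕ τ.Edge))

theorem edge_cases (u : (PTree.graft t k σ τ).Edge) :
    u = newEdge t k σ τ ∨ (∃ e, u = branchEdge t k σ τ e) ∨ ∃ e, u = trunkEdge t k σ τ e := by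
  rcases u with _ | u | u
  · exact .inl rfl
  · exact .inr (.inl ⟨u, rfl⟩)
  · exact .inr (.inr ⟨u, rfl⟩)

theorem trunkEdge_ne_newEdge (e : τ.Edge) : trunkEdge t k σ τ e ≠ newEdge t k σ τ :=
  Option.some_ne_none _

theorem trunkEdge_ne_branchEdge (e : τ.Edge) (e' : σ.Edge) :
    trunkEdge t k σ τ e ≠ branchEdge t k σ τ e' :=
  fun h => Sum.inr_ne_inl (Option.some.inj h)

theorem branchEdge_injective : Function.Injective (branchEdge t k σ τ) :=
  fun _ _ h => Sum.inl.inj (Option.some.inj h)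

theorem trunkEdge_injective : Function.Injective (trunkEdge t k σ τ) :=
  fun _ _ h => Sum.inr.inj (Option.some.inj h)

end PTree

namespace Data

variable {N : Type u} {P : Type v} {d : ℕ} (D : Data N P d) {I J : Type}

/-- The operation on values that corresponds to adding an edge of kernel type below a tree. -/
def kernelEdge (g : D.TMinus →ₐ[ℝ] ℝ) (z : Space d) (b : ℕ) (t : P) (k : MI d) :
    Values (ExtTypes N P J) d →+ Values (ExtTypes N P J) d :=
  sumHom fun c =>
    AddMonoidAlgebra.singleAddHom
      ((0, 0, {(.inr t, k, Tree.assemble c.1)}), c.2 + (D.kernelDeg t - D.sdeg k))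
    + ∑ ε ∈ Finset.Iic (fun _ => b : MI d),
      (AddMonoidAlgebra.singleAddHom
        ((ε, 0, 0), D.sdeg ε + (D.kernelDeg t - D.sdeg (k + ε) + c.2))).comp
        ((((∏ i, (ε i).factorial : ℕ) : ℝ)⁻¹ * D.componentValue g c.1) •
          D.integration z t (k + ε) c.2).toAddMonoidHom

theorem kernelEdge_single (g : D.TMinus →ₐ[ℝ] ℝ) (z : Space d) (b : ℕ) (t : P) (k : MI d)
    (c : Tree.Exploded (ExtTypes N P J) d × ℝ) (φ : Smooth d) :
    D.kernelEdge g z b t k (AddMonoidAlgebra.single c φ) =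
      AddMonoidAlgebra.single
        ((0, 0, {(.inr t, k, Tree.assemble c.1)}), c.2 + (D.kernelDeg t - D.sdeg k)) φ
      + ∑ ε ∈ Finset.Iic (fun _ => b : MI d), AddMonoidAlgebra.single
        ((ε, 0, 0), D.sdeg ε + (D.kernelDeg t - D.sdeg (k + ε) + c.2))
        ((((∏ i, (ε i).factorial : ℕ) : ℝ)⁻¹ * D.componentValue g c.1) •
          D.integration z t (k + ε) c.2 φ) := by
  rw [kernelEdge, sumHom_single]
  simp [AddMonoidHom.finsetSum_apply]

/-- The value of the sum over subforests of the tree with a single node. -/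
def nodeValue (z : Space d) (n : MI d) (o : ODec (ExtTypes N P J) d) :
    Values (ExtTypes N P J) d :=
  ∑ m ∈ Finset.Iic n, AddMonoidAlgebra.single
    ((m, o, 0), D.sdeg (n - m) + ((D.ext J).odeg o + D.sdeg m))
    (((∏ i, (n i).choose (m i) : ℕ) : ℝ) • monomial z (n - m))

open Classical in
/-- The value of the sum over subforests of a noise edge of type `t` with noise `φ`. An edge with
type in `N × J` cannot belong to the subforest. -/
def noiseEdge (b : ℕ) (t : N ⊕ N × J) (k : MI d) (φ : Smooth d) :
    Values (ExtTypes N P J) d :=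
  (if IsHat (.inl t : ExtTypes N P J) then 0 else
    AddMonoidAlgebra.single
      ((0, 0, {(.inl t, k, Tree.root 0 0)}), (D.ext J).noiseDeg t - D.sdeg k) 1)
  + ∑ ε ∈ Finset.Iic (fun _ => b : MI d), AddMonoidAlgebra.single
      ((ε, 0, 0), D.sdeg ε + ((D.ext J).noiseDeg t - D.sdeg (k + ε)))
      ((((∏ i, (ε i).factorial : ℕ) : ℝ)⁻¹) • multiDₗ (k + ε) φ)

/-- The value of the sum over subforests of a tree, when the noise edge `e` is realized by the
function `η e`. The types are recorded with indices replaced by `j`. -/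
def expansion (g : D.TMinus →ₐ[ℝ] ℝ) (z : Space d) (b : ℕ) (j : J) :
    (τ : PTree (ExtTypes N P I) d) → (τ.Edge → Smooth d) → Values (ExtTypes N P J) d
  | .root n o => fun _ => D.nodeValue z n (o.map (setIdx j))
  | .graft (.inl t) k σ τ => fun η =>
      D.noiseEdge b (Sum.map id (fun a => (a.1, j)) t) k (η (PTree.newEdge (.inl t) k σ τ)) *
        expansion g z b j τ fun e => η (PTree.trunkEdge (.inl t) k σ τ e)
  | .graft (.inr t) k σ τ => fun η =>
      D.kernelEdge g z b t k
          (expansion g z b j σ fun e => η (PTree.branchEdge (.inr t) k σ τ e)) *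
        expansion g z b j τ fun e => η (PTree.trunkEdge (.inr t) k σ τ e)

/-- For a type in `N × J` the term with the edge inside the subforest is absent. That term has the
constant coefficient 1 and would destroy additivity for an ordinary noise. -/
theorem noiseEdge_add (b : ℕ) {t : N ⊕ N × J} (ht : IsHat (.inl t : ExtTypes N P J)) (k : MI d)
    (φ ψ : Smooth d) :
    D.noiseEdge b t k (φ + ψ) = D.noiseEdge b t k φ + D.noiseEdge b t k ψ := by
  simp only [noiseEdge, if_pos ht, zero_add, map_add, smul_add]
  rw [← Finset.sum_add_distrib]
  refine Finset.sum_congr rfl fun ε _ => ?_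
  exact map_add (AddMonoidAlgebra.singleAddHom _) _ _

/-- At each grafting the slot `u` lies in exactly one of the new edge, the branch and the trunk. The
remaining factor agrees for all three families, and `noiseEdge` (for such types), `kernelEdge` and
multiplication are additive. -/
theorem expansion_add (g : D.TMinus →ₐ[ℝ] ℝ) (z : Space d) (b : ℕ) (j : J)
    {τ : PTree (ExtTypes N P I) d} (hτ : τ.Conforms (D.ext I)) (u : τ.Edge)
    (hu : IsHat (τ.typ u)) {η η₁ η₂ : τ.Edge → Smooth d} (h₁ : ∀ e, e ≠ u → η e = η₁ e)
    (h₂ : ∀ e, e ≠ u → η e = η₂ e) (h : η₁ u = η u + η₂ u) :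
    D.expansion g z b j τ η₁ = D.expansion g z b j τ η + D.expansion g z b j τ η₂ := by
  induction τ with
  | root n o => exact u.elim
  | graft t k σ τ ih ih' =>
    obtain rfl | ⟨u, rfl⟩ | ⟨u, rfl⟩ := PTree.edge_cases u
    · have e₁ : ∀ e, η (PTree.trunkEdge t k σ τ e) = η₁ (PTree.trunkEdge t k σ τ e) :=
        fun e => h₁ _ (PTree.trunkEdge_ne_newEdge e)
      have e₂ : ∀ e, η (PTree.trunkEdge t k σ τ e) = η₂ (PTree.trunkEdge t k σ τ e) :=
        fun e => h₂ _ (PTree.trunkEdge_ne_newEdge e)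
      obtain ⟨a, rfl⟩ : ∃ a, t = Sum.inl (Sum.inr a) := hu
      simp only [expansion, ← e₁, ← e₂]
      have ha : IsHat (.inl (Sum.map id (fun a => (a.1, j)) (Sum.inr a)) : ExtTypes N P J) :=
        ⟨(a.1, j), rfl⟩
      rw [h, D.noiseEdge_add b ha, add_mul]
    · have e₁ : ∀ e, η (PTree.trunkEdge t k σ τ e) = η₁ (PTree.trunkEdge t k σ τ e) :=
        fun e => h₁ _ (PTree.trunkEdge_ne_branchEdge e u)
      have e₂ : ∀ e, η (PTree.trunkEdge t k σ τ e) = η₂ (PTree.trunkEdge t k σ τ e) :=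
        fun e => h₂ _ (PTree.trunkEdge_ne_branchEdge e u)
      rcases t with t | t
      -- By conformity a noise edge ends in a bare node, so `u` cannot lie above it.
      · obtain rfl : σ = .root 0 0 := hτ.1
        exact u.elim
      · simp only [expansion, ← e₁, ← e₂]
        rw [ih (η := fun e => η (PTree.branchEdge _ k σ τ e))
          (η₁ := fun e => η₁ (PTree.branchEdge _ k σ τ e))
          (η₂ := fun e => η₂ (PTree.branchEdge _ k σ τ e)) hτ.1.2 u hu
          (fun e he => h₁ _ fun h => he (PTree.branchEdge_injective h))
          (fun e he => h₂ _ fun h => he (PTree.branchEdge_injective h)) h, map_add, add_mul]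
    · have e₁ : ∀ e, η (PTree.branchEdge t k σ τ e) = η₁ (PTree.branchEdge t k σ τ e) :=
        fun e => h₁ _ (PTree.trunkEdge_ne_branchEdge u e).symm
      have e₂ : ∀ e, η (PTree.branchEdge t k σ τ e) = η₂ (PTree.branchEdge t k σ τ e) :=
        fun e => h₂ _ (PTree.trunkEdge_ne_branchEdge u e).symm
      have e₃ := h₁ _ (PTree.trunkEdge_ne_newEdge u).symm
      have e₄ := h₂ _ (PTree.trunkEdge_ne_newEdge u).symm
      have e₀ := ih' (η := fun e => η (PTree.trunkEdge _ k σ τ e))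
          (η₁ := fun e => η₁ (PTree.trunkEdge _ k σ τ e))
          (η₂ := fun e => η₂ (PTree.trunkEdge _ k σ τ e)) hτ.2 u hu
          (fun e he => h₁ _ fun h => he (PTree.trunkEdge_injective h))
          (fun e he => h₂ _ fun h => he (PTree.trunkEdge_injective h)) h
      rcases t with t | t <;> simp only [expansion, ← e₁, ← e₂, ← e₃, ← e₄] <;> rw [e₀, mul_add]

/-- The function that realizes a type: the noise for noise types, zero for kernel types. -/
def typeNoise (ξ : N ⊕ N × I → Smooth d) : ExtTypes N P I → Smooth d :=
  Sum.elim ξ 0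

section

variable (g : D.TMinus →ₐ[ℝ] ℝ) (ξ : N ⊕ N × I → Smooth d) (z : Space d) {ρ : I → J}


theorem cutsValue_cutNode (n : MI d) (o : ODec (ExtTypes N P I) d) :
    D.cutsValue g ξ z ρ ((D.ext I).cutNode n o) = D.nodeValue z n (o.map (reindex ρ)) := by
  rw [cutNode, map_sum]
  refine Finset.sum_congr rfl fun m _ => ?_
  rw [cutsValue_single_of_hatFree _ _ _ _ _ (hatFree_node _ _), degPlus_assemble,
    smoothModel_assemble, odeg_add, odeg_polyO,
    D.odeg_ext_map (reindex ρ) (by rintro ((t | t) | t) <;> rfl)]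
  congr 1
  · simp
    exact ⟨rfl, rfl⟩
  · have : D.extendChar g I (MvPolynomial.C ((∏ i, (n i).choose (m i) : ℕ) : ℝ)) =
        ((∏ i, (n i).choose (m i) : ℕ) : ℝ) := (D.extendChar g I).commutes _
    rw [this]
    simp

/-- Both sides are additive in `S`. On a single term the homogeneity and lift of the contracted
branch determine those of the tree with the new edge, and closing the component above the edge costs
exactly the factor `componentValue`. -/
theorem cutsValue_cutEdge_kernel {ρ' : J → I} (hρ : Function.LeftInverse ρ' ρ) (b : ℕ) (t : P) (k : MI d) (S : (D.ext I).Cuts) :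
    D.cutsValue g ξ z ρ ((D.ext I).cutEdge b (.inr t) k S) =
      D.kernelEdge g z b t k (D.cutsValue g ξ z ρ S) := by
  let F : (D.ext I).Cuts →+ Values (ExtTypes N P J) d :=
    (D.cutsValue g ξ z ρ).toAddMonoidHom.comp
      ⟨⟨(D.ext I).cutEdge b (.inr t) k, Finsupp.sum_zero_index⟩, (D.ext I).cutEdge_add b (.inr t) k⟩
  refine DFunLike.congr_fun (AddMonoidAlgebra.addMonoidHom_ext (f := F)
    (g := (D.kernelEdge g z b t k).comp (D.cutsValue g ξ z ρ).toAddMonoidHom) fun x p => ?_) S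
  change D.cutsValue g ξ z ρ ((D.ext I).cutEdge b (.inr t) k _) =
    D.kernelEdge g z b t k (D.cutsValue g ξ z ρ _)
  have hC : ∀ c : ℝ, D.extendChar g I (MvPolynomial.C c) = c := (D.extendChar g I).commutes
  have ht : ¬ IsHat (.inr t : ExtTypes N P I) := by simp [IsHat]
  rw [cutEdge_single, map_add, map_sum]
  by_cases hx : HatFree x.1
  · rw [cutsValue_single_of_hatFree _ _ _ _ _ hx, kernelEdge_single,
      cutsValue_single_of_hatFree _ _ _ _ _ ((hatFree_edge _ _ _ _ _).2 ⟨ht, hx⟩)]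
    congr 1
    · refine congrArg₂ AddMonoidAlgebra.single (Prod.ext ?_ ?_) ?_
      · simp [Tree.explodedMap, ODec.map_zero, ← Tree.assemble_explodedMap]
        rfl
      · simp only [degPlus_assemble, odeg_add, odeg_edgeO]
        change _ + (_ + (D.kernelDeg t - D.sdeg k)) + _ = _
        ring
      · simp only [smoothModel_assemble]
    · refine Finset.sum_congr rfl fun ε _ => ?_
      rw [cutsValue_single_of_hatFree _ _ _ _ _ (hatFree_node _ _)]
      refine congrArg₂ AddMonoidAlgebra.single (Prod.ext ?_ ?_) ?_
      · simp [Tree.explodedMap, ODec.map_zero]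
      · simp only [degPlus_assemble _ (_, _, _), odeg_polyO, sdeg_zero, Multiset.map_singleton,
          Multiset.sum_singleton, Nat.cast_zero, zero_add]
        rfl
      · rw [smoothModel_assemble _ _ _ (_, _, _)]
        simp only [map_mul, hC, monomial_zero, one_mul, Multiset.map_singleton,
          Multiset.prod_singleton, map_smul, smul_smul, componentValue,
          D.extendChar_component_reindex g hρ]
        rfl
  -- An edge of `N × I` in the component above stays in the root component if the new edge is
  -- contracted; otherwise that component is complete and the character gives 0.
  · rw [cutsValue_single_of_not_hatFree _ _ _ _ _ hx, map_zero,
      cutsValue_single_of_not_hatFree _ _ _ _ _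
        (fun h => hx ((hatFree_edge _ _ _ _ _).1 h).2), zero_add]
    refine Finset.sum_eq_zero fun ε _ => ?_
    rw [cutsValue_single_of_hatFree _ _ _ _ _ (hatFree_node _ _)]
    simp [D.extendChar_component_eq_zero g hx]

/-- A bare node admits only the decoration `m = 0`, so it gives the unit of the algebra of cuts. -/
theorem cutNode_zero (D : Data N P d) : D.cutNode 0 0 = (AddMonoidAlgebra.single 0 1 : D.Cuts) := by
  have h : Finset.Iic (0 : MI d) = {0} := by
    ext m
    simp
  have h' : (polyO (0 : MI d) : ODec (N ⊕ P) d) = 0 := by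
    simp only [polyO, Pi.zero_apply, Nat.cast_zero]
    rfl
  rw [cutNode, h, Finset.sum_singleton]
  simp [h']
  rfl

theorem cutsValue_cutEdge_noise (b : ℕ) (t : N ⊕ N × I) (k : MI d) :
    D.cutsValue g ξ z ρ ((D.ext I).cutEdge b (.inl t) k ((D.ext I).cutNode 0 0)) =
      D.noiseEdge b (Sum.map id (Prod.map id ρ) t) k (ξ t) := by
  have hC : ∀ c : ℝ, D.extendChar g I (MvPolynomial.C c) = c := (D.extendChar g I).commutes
  have hdeg : (D.ext J).noiseDeg (Sum.map id (Prod.map id ρ) t) = (D.ext I).noiseDeg t := by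
    rcases t with t | t <;> rfl
  have hhat : IsHat (.inl (Sum.map id (Prod.map id ρ) t) : ExtTypes N P J) ↔
      IsHat (.inl t : ExtTypes N P I) := by
    rcases t with t | t <;> simp [IsHat]
  have hcomp : (D.ext I).component 0 = 1 := by simp [component]
  rw [cutNode_zero, cutEdge_single, map_add, map_sum, noiseEdge, hdeg]
  congr 1
  · by_cases ht : IsHat (.inl t : ExtTypes N P I)
    · rw [if_pos (hhat.2 ht), cutsValue_single_of_not_hatFree]
      exact fun h => ((hatFree_edge _ _ _ _ 0).1 h).1 ht
    · rw [if_neg (hhat.not.2 ht), cutsValue_single_of_hatFree]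
      · refine congrArg₂ AddMonoidAlgebra.single (Prod.ext ?_ ?_) ?_
        · simp [Tree.explodedMap, ODec.map_zero, ← Tree.assemble_zero,
            ← Tree.assemble_explodedMap]
          exact ⟨rfl, rfl⟩
        · simp [degPlus_assemble, odeg_edgeO, sdeg_zero]
          rfl
        · simp [smoothModel_assemble, monomial_zero]
      · exact (hatFree_edge _ _ _ _ 0).2 ⟨ht, hatFree_zero⟩
  · refine Finset.sum_congr rfl fun ε _ => ?_
    rw [cutsValue_single_of_hatFree _ _ _ _ _ (hatFree_node _ _)]
    refine congrArg₂ AddMonoidAlgebra.single (Prod.ext ?_ ?_) ?_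
    · simp [Tree.explodedMap, ODec.map_zero]
    · simp [degPlus_assemble, odeg_polyO, sdeg_zero, odeg_zero]
      rfl
    · simp only [Prod.fst_zero, hcomp, mul_one, hC, smoothModel_assemble, monomial_zero, one_mul,
        Multiset.map_singleton, Multiset.prod_singleton]
      rfl

/-- The type of the edge is recorded only in the term where the edge is contracted, and that term is
absent for types in `N × J`. The homogeneity does not see the index. -/
theorem noiseEdge_setIdx (b : ℕ) (t : N ⊕ N × I) (k : MI d) (φ : Smooth d) (j j' : J) :
    D.noiseEdge b (Sum.map id (fun a => (a.1, j)) t) k φ =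
      D.noiseEdge b (Sum.map id (fun a => (a.1, j')) t) k φ := by
  rcases t with t | t
  · rfl
  · have h : ∀ j, IsHat (.inl (Sum.map id (fun a => (a.1, j)) (.inr t)) : ExtTypes N P J) :=
      fun j => ⟨_, rfl⟩
    rw [noiseEdge, noiseEdge, if_pos (h j), if_pos (h j')]
    rfl

theorem cutsValue_cutEdge_setIdx {I' : Type} (b : ℕ) (t : N ⊕ N × I') (k : MI d) (i : I) (j : J) :
    D.cutsValue g ξ z ρ
        ((D.ext I).cutEdge b (setIdx i (.inl t)) k ((D.ext I).cutNode 0 0)) =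
      D.noiseEdge b (Sum.map id (fun a => (a.1, j)) t) k
        (typeNoise ξ (setIdx i (.inl t : ExtTypes N P I'))) := by
  have hs : (setIdx i (.inl t) : ExtTypes N P I) = .inl (Sum.map id (fun a => (a.1, i)) t) := rfl
  rw [hs, cutsValue_cutEdge_noise, Sum.map_map, D.noiseEdge_setIdx b t k _ j (ρ i)]
  rfl

/-- `cuts` is a product over nodes and edges and `cutsValue` is multiplicative, so the factors can
be matched one by one. The index assignment `c` survives only through the noises; the types in the
extended decorations receive the fixed index `i`, recorded as `ρ i`. -/
theorem cutsValue_cuts {ρ' : J → I} (hρ : Function.LeftInverse ρ' ρ) {I' : Type} (b : ℕ) (i : I)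
    {τ : PTree (ExtTypes N P I') d} (hτ : τ.Conforms (D.ext I')) (c : τ.Edge → I) :
    D.cutsValue g ξ z ρ ((D.ext I).cuts b (τ.retype (setIdx i) fun e => setIdx (c e) (τ.typ e))) =
      D.expansion g z b (ρ i) τ fun e => typeNoise ξ (setIdx (c e) (τ.typ e)) := by
  induction τ with
  | root n o =>
    simp only [PTree.retype, cuts, expansion]
    rw [cutsValue_cutNode, ODec.map_map, reindex_comp_setIdx]
  | graft t k σ τ ih ih' =>
    have e' := ih' hτ.2 fun e => c (PTree.trunkEdge t k σ τ e)
    rcases t with t | t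
    · obtain rfl : σ = .root 0 0 := hτ.1
      have h := D.cutsValue_cutEdge_setIdx g ξ z (ρ := ρ) b t k
        (c (PTree.newEdge (.inl t) k (.root 0 0) τ)) (ρ i)
      simp only [PTree.retype, cuts, expansion, map_mul, ODec.map_zero]
      exact congrArg₂ (· * ·) h e'
    · have e := ih hτ.1.2 fun e => c (PTree.branchEdge _ k σ τ e)
      simp only [PTree.retype, cuts, expansion, map_mul]
      refine congrArg₂ (· * ·) ?_ e'
      refine (D.cutsValue_cutEdge_kernel g ξ z hρ b t k _).trans ?_
      exact congrArg (D.kernelEdge g z b t k) e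

end

end Data

/-! ## Telescoping -/

/-- A telescoping sum over a finite totally ordered set. -/
theorem sum_sub_of_linearOrder {α M : Type*} [LinearOrder α] [Fintype α] [AddCommGroup M]
    (F : Set α → M) :
    ∑ u, (F {e | e ≤ u} - F {e | e < u}) = F Set.univ - F ∅ := by
  -- Stated for finite subsets so that elements can be added in increasing order: a new maximum
  -- leaves the earlier summands unchanged.
  have key : ∀ s : Finset α,
      ∑ u ∈ s, (F {e | e ∈ s ∧ e ≤ u} - F {e | e ∈ s ∧ e < u}) = F s - F ∅ := by
    intro s
    induction s using Finset.induction_on_max with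
    | empty => simp
    | insert a s hs ih =>
      have ha : a ∉ s := fun h => lt_irrefl _ (hs a h)
      rw [Finset.sum_insert ha]
      have h1 : {e | e ∈ insert a s ∧ e ≤ a} = (insert a s : Finset α) := by
        ext e
        simp only [Finset.mem_insert, Set.mem_ofPred_eq, Finset.coe_insert, Set.mem_insert_iff,
          Finset.mem_coe, and_iff_left_iff_imp]
        rintro (rfl | h)
        exacts [le_rfl, (hs e h).le]
      have h2 : {e | e ∈ insert a s ∧ e < a} = s := by
        ext e
        simp only [Finset.mem_insert, Set.mem_ofPred_eq, Finset.mem_coe]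
        constructor
        · rintro ⟨rfl | h, h'⟩
          exacts [absurd h' (lt_irrefl _), h]
        · exact fun h => ⟨.inr h, hs e h⟩
      have h3 : ∑ u ∈ s, (F {e | e ∈ insert a s ∧ e ≤ u} - F {e | e ∈ insert a s ∧ e < u}) =
          ∑ u ∈ s, (F {e | e ∈ s ∧ e ≤ u} - F {e | e ∈ s ∧ e < u}) := by
        refine Finset.sum_congr rfl fun u hu => ?_
        have hau := hs u hu
        congr 2
        · ext e
          simp only [Finset.mem_insert, Set.mem_ofPred_eq]
          constructor
          · rintro ⟨rfl | h, h'⟩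
            exacts [absurd h' hau.not_ge, ⟨h, h'⟩]
          · exact fun h => ⟨.inr h.1, h.2⟩
        · ext e
          simp only [Finset.mem_insert, Set.mem_ofPred_eq]
          constructor
          · rintro ⟨rfl | h, h'⟩
            exacts [absurd h' hau.not_gt, ⟨h, h'⟩]
          · exact fun h => ⟨.inr h.1, h.2⟩
      rw [h1, h2, h3, ih]
      abel
  simpa using key Finset.univ

/-- `IdxI` has a single element. Hence an original tree is itself a retyping, and the same lemmas
serve both sides of the identity. -/
theorem PTree.retype_typ {N : Type u} {P : Type v} {d : ℕ} (τ : PTree (ExtTypes N P IdxI) d) :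
    τ.retype (setIdx IdxI.h) (fun e => setIdx IdxI.h (τ.typ e)) = τ := by
  have hid : (setIdx IdxI.h : ExtTypes N P IdxI → ExtTypes N P IdxI) = id := by
    funext t
    rcases t with (t | ⟨t, ⟨⟩⟩) | t <;> rfl
  rw [hid]
  induction τ with
  | root n o => simp [PTree.retype, ODec.map_id]
  | graft t k σ τ ih ih' => exact congrArg₂ (PTree.graft t k) ih ih'

/-- The edge underlying an element of `L̂(τ)`. -/
def HatLeaf.edge {N : Type u} {P : Type v} {d : ℕ} {I : Type} {τ : PTree (ExtTypes N P I) d}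
    (v : HatLeaf τ) : τ.Edge :=
  v.1

theorem HatLeaf.edge_injective {N : Type u} {P : Type v} {d : ℕ} {I : Type}
    (τ : PTree (ExtTypes N P I) d) : Function.Injective (HatLeaf.edge : HatLeaf τ → τ.Edge) :=
  fun _ _ h => Subtype.ext h

namespace Data

variable {N : Type u} {P : Type v} {d : ℕ} (D : Data N P d) {I I' : Type}

/-- The cutoff for `ε` is built from homogeneities, which ignore indices, so original and retyped
trees are expanded with the same cutoff. -/
theorem epsBound_retype (i : I) (τ : PTree (ExtTypes N P I') d) (c : τ.Edge → I) :
    (D.ext I).epsBound (τ.retype (setIdx i) fun e => setIdx (c e) (τ.typ e)) =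
      (D.ext I').epsBound τ := by
  have h : (D.ext I).negPart (τ.retype (setIdx i) fun e => setIdx (c e) (τ.typ e)) =
      (D.ext I').negPart τ := by
    induction τ with
    | root n o => rfl
    | graft t k σ τ ih ih' =>
      have e := ih fun e => c (PTree.branchEdge _ k σ τ e)
      have e' := ih' fun e => c (PTree.trunkEdge _ k σ τ e)
      have ht : (D.ext I).tdeg (setIdx (c (PTree.newEdge t k σ τ)) t) = (D.ext I').tdeg t := by
        rw [tdeg_ext, tdeg_ext, forget_setIdx]
      exact congrArg₂ (· + ·) (congrArg₂ (· + ·) (congrArg (fun x => max 0 (_ - x)) ht) e) e'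
  rw [epsBound, epsBound, h]

theorem model_renorm_retype (g : D.TMinus →ₐ[ℝ] ℝ) (ξ : N ⊕ N × I → Smooth d) (z : Space d)
    {J : Type} {ρ : I → J} {ρ' : J → I} (hρ : Function.LeftInverse ρ' ρ) (i : I)
    {τ : PTree (ExtTypes N P I') d} (hτ : τ.Conforms (D.ext I')) (c : τ.Edge → I) :
    (D.ext I).model (fun t => ξ t) z ((D.ext I).renorm (D.extendChar g I)
        (Finsupp.single (Quotient.mk _
          (τ.retype (setIdx i) fun e => setIdx (c e) (τ.typ e))) (1 : ℝ))) =
      D.pairing g (D.expansion g z ((D.ext I').epsBound τ) (ρ i) τ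
        fun e => typeNoise ξ (setIdx (c e) (τ.typ e))) := by
  rw [D.model_renorm g ξ z hρ, D.cutsValue_cuts g ξ z hρ _ _ hτ, epsBound_retype]

/-- The noises `(f, (h_i)_{i ∈ I})` as smooth functions. -/
theorem coe_extNoise (f : N → Smooth d) (h : I → N → Smooth d) :
    (fun t => ((Sum.elim f (fun a : N × I => h a.2 a.1) t : Smooth d) : Space d → ℝ)) =
      extNoise (fun t => f t) fun i t => h i t := by
  funext t
  rcases t with t | t <;> rfl

open Classical in
theorem telescope_tree (g : D.TMinus →ₐ[ℝ] ℝ) (z : Space d) (f h k : N → Smooth d)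
    {τ : PTree (ExtTypes N P IdxI) d} (hτ : τ.Conforms (D.ext IdxI))
    (ord : LinearOrder (HatLeaf τ)) :
    (D.ext IdxI).model (extNoise (fun t => f t) fun _ t => h t) z
        ((D.ext IdxI).renorm (D.extendChar g IdxI) (Finsupp.single (Quotient.mk _ τ) (1 : ℝ)))
      - (D.ext IdxI).model (extNoise (fun t => f t) fun _ t => k t) z
          ((D.ext IdxI).renorm (D.extendChar g IdxI) (Finsupp.single (Quotient.mk _ τ) (1 : ℝ)))
    = ∑ u : HatLeaf τ, (D.ext IdxJ).model (extNoise (fun t => f t)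
          (noiseJ (fun t => h t) fun t => k t)) z
        ((D.ext IdxJ).renorm (D.extendChar g IdxJ) (Finsupp.single
          (Quotient.mk _ (τ.retype (setIdx IdxJ.h) (teleType τ ord u))) (1 : ℝ))) := by
  -- `c e` is the noise family used at `e` if that edge lies in `L̂(τ)`; other noise edges always
  -- carry `f`.
  let η : (τ.Edge → N → Smooth d) → τ.Edge → Smooth d := fun c e =>
    Sum.elim (Sum.elim f fun a => c e a.1) 0 (τ.typ e)
  let G : (τ.Edge → N → Smooth d) → Space d → ℝ := fun c =>
    D.pairing g (D.expansion g z ((D.ext IdxI).epsBound τ) IdxJ.h τ (η c))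
  have hI : ∀ h : N → Smooth d, (D.ext IdxI).model (extNoise (fun t => f t) fun _ t => h t) z
      ((D.ext IdxI).renorm (D.extendChar g IdxI) (Finsupp.single (Quotient.mk _ τ) (1 : ℝ))) =
      G fun _ => h := by
    intro h
    rw [← coe_extNoise f fun _ => h]
    -- The constant map from `IdxI` to `IdxJ` has a left inverse since `IdxI` is a singleton. It
    -- moves both lifts on the left to the indices of the right-hand side.
    have := D.model_renorm_retype g (Sum.elim f fun a => h a.1) z
      (ρ := fun _ => IdxJ.h) (ρ' := fun _ => IdxI.h) (fun _ => rfl) IdxI.h hτ fun _ => IdxI.h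
    rw [PTree.retype_typ] at this
    refine this.trans ?_
    congr 2
    funext e
    simp only [η]
    rcases τ.typ e with (t | t) | t <;> rfl
  let hJ : IdxJ → N → Smooth d := fun i => match i with
    | .h => h
    | .k => k
    | .hk => h - k
  have hJ' : (fun i t => ((hJ i t : Smooth d) : Space d → ℝ)) =
      noiseJ (fun t => h t) fun t => k t := by
    funext i t
    rcases i <;> rfl
  have hJJ : ∀ c : τ.Edge → IdxJ, (D.ext IdxJ).model (extNoise (fun t => f t)
          (noiseJ (fun t => h t) fun t => k t)) z
        ((D.ext IdxJ).renorm (D.extendChar g IdxJ) (Finsupp.single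
          (Quotient.mk _ (τ.retype (setIdx IdxJ.h) fun e => setIdx (c e) (τ.typ e))) (1 : ℝ))) =
      G fun e => hJ (c e) := by
    intro c
    rw [← hJ', ← coe_extNoise f hJ]
    refine (D.model_renorm_retype g (Sum.elim f fun a => hJ a.2 a.1) z
      (ρ := id) (ρ' := id) (fun _ => rfl) IdxJ.h hτ c).trans ?_
    congr 2
    funext e
    simp only [η]
    rcases τ.typ e with (t | t) | t <;> rfl
  have hG : ∀ c c' : τ.Edge → N → Smooth d, (∀ v : HatLeaf τ, c v.edge = c' v.edge) →
      G c = G c' := by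
    intro c c' hc
    have : η c = η c' := by
      funext e
      simp only [η]
      rcases ht : τ.typ e with (t | t) | t
      · rfl
      · exact congrFun (hc ⟨e, t, ht⟩) t.1
      · rfl
    simp only [G, this]
  -- Extension by zero off `L̂(τ)`; by `hG` the values there are irrelevant.
  let E : (HatLeaf τ → N → Smooth d) → τ.Edge → N → Smooth d := fun m =>
    Function.extend HatLeaf.edge m 0
  have hE : ∀ m v, E m (HatLeaf.edge v) = m v := fun m v =>
    (HatLeaf.edge_injective τ).extend_apply m 0 v
  let F : Set (HatLeaf τ) → Space d → ℝ := fun S => G (E fun v => if v ∈ S then h else k)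
  have huniv : F Set.univ = G fun _ => h :=
    hG _ _ fun v => (hE _ v).trans (if_pos (Set.mem_univ v))
  have hempty : F ∅ = G fun _ => k := hG _ _ fun v => (hE _ v).trans (if_neg (Set.notMem_empty v))
  rw [hI, hI, ← huniv, ← hempty, ← sum_sub_of_linearOrder]
  refine Finset.sum_congr rfl fun u _ => ?_
  -- The assignment of `teleType` with a free value `m` at `u`. The choices `m = h` and `m = k` give
  -- the two consecutive terms of the telescoping sum, and `m = h - k` gives the summand of `u`.
  let c : (N → Smooth d) → τ.Edge → N → Smooth d := fun m =>
    E fun v => if v < u then h else if u = v then m else k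
  have hcv : ∀ m (v : HatLeaf τ), c m v.edge = if v < u then h else if u = v then m else k :=
    fun m v => hE _ v
  have hle : F {v | v ≤ u} = G (c h) := hG _ _ fun v => by
    rw [hE, hcv]
    rcases lt_trichotomy v u with hv | hv | hv
    · rw [if_pos hv, if_pos (show v ∈ {v | v ≤ u} from hv.le)]
    · rw [if_pos (show v ∈ {v | v ≤ u} from hv.le), if_neg hv.not_lt, if_pos hv.symm]
    · rw [if_neg (show v ∉ {v | v ≤ u} from hv.not_ge), if_neg hv.not_gt, if_neg hv.ne]
  have hlt : F {v | v < u} = G (c k) := hG _ _ fun v => by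
    rw [hE, hcv, ite_self]
    by_cases hv : v < u
    · rw [if_pos hv, if_pos (show v ∈ {v | v < u} from hv)]
    · rw [if_neg hv, if_neg (show v ∉ {v | v < u} from hv)]
  have hc : ∀ m m' e, e ≠ u.edge → c m e = c m' e := by
    intro m m' e he
    by_cases hv : ∃ v : HatLeaf τ, v.edge = e
    · obtain ⟨v, rfl⟩ := hv
      have hvu : ¬ u = v := fun hu => he (congrArg HatLeaf.edge hu.symm)
      simp only [hcv, if_neg hvu]
    · exact (Function.extend_apply' _ _ _ hv).trans (Function.extend_apply' _ _ _ hv).symm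
  have hcu : ∀ m, c m u.edge = m := fun m => by
    simp only [hcv, if_neg (lt_irrefl u), if_true]
  refine Eq.trans ?_ (hJJ fun e => if he : IsHat (τ.typ e) then
      (if ord.lt ⟨e, he⟩ u then IdxJ.h else if u = ⟨e, he⟩ then IdxJ.hk else IdxJ.k)
    else IdxJ.h).symm
  refine Eq.trans ?_ (hG (c (h - k)) _ fun v => ?_)
  -- Additivity in the slot `u`, applied to `h = (h - k) + k`.
  · rw [hle, hlt, sub_eq_iff_eq_add]
    refine Eq.trans (congrArg (D.pairing g) (D.expansion_add g z _ _ hτ u.edge u.2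
      (η := η (c (h - k))) (η₂ := η (c k)) (fun e he => ?_) (fun e he => ?_) ?_)) (map_add _ _ _)
    · simp only [η, hc _ h e he]
    · simp only [η, hc _ k e he]
    · obtain ⟨a, ha⟩ : IsHat (τ.typ u.edge) := u.2
      simp only [η, hcu, ha]
      simp
  · refine Eq.trans ?_ (congrArg hJ (dif_pos v.2)).symm
    refine (hcv _ v).trans ?_
    refine Eq.trans ?_ (apply_ite hJ _ _ _).symm
    refine if_congr Iff.rfl rfl ?_
    by_cases hv : u = v
    · exact (if_pos hv).trans (congrArg hJ (if_pos (c := u = (⟨v.edge, v.2⟩ : HatLeaf τ))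
        (t := IdxJ.hk) (e := IdxJ.k) hv)).symm
    · exact (if_neg hv).trans (congrArg hJ (if_neg (c := u = (⟨v.edge, v.2⟩ : HatLeaf τ))
        (t := IdxJ.hk) (e := IdxJ.k) hv)).symm

end Data

end RegStr

end

/-! ### The identity on all of `𝓣^ex` by linearity. -/

theorem mainTheorem9 {N : Type*} {P : Type*} {d : ℕ} (D : RegStr.Data N P d)
    (ord : ∀ τ : RegStr.Tree (RegStr.ExtTypes N P RegStr.IdxI) d,
      LinearOrder (RegStr.HatLeaf (Quotient.out τ)))
    (f h k : N → RegStr.Space d → ℝ)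
    (hf : ∀ t, ContDiff ℝ ∞ (f t)) (hh : ∀ t, ContDiff ℝ ∞ (h t)) (hk : ∀ t, ContDiff ℝ ∞ (k t))
    (g : D.TMinus →ₐ[ℝ] ℝ) (z : RegStr.Space d) :
    ∀ τ ∈ (D.ext RegStr.IdxI).Tex,
      (D.ext RegStr.IdxI).model (RegStr.extNoise f fun _ => h) z
          ((D.ext RegStr.IdxI).renorm (D.extendChar g RegStr.IdxI) τ)
        - (D.ext RegStr.IdxI).model (RegStr.extNoise f fun _ => k) z
            ((D.ext RegStr.IdxI).renorm (D.extendChar g RegStr.IdxI) τ)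
      = (D.ext RegStr.IdxJ).model (RegStr.extNoise f (RegStr.noiseJ h k)) z
          ((D.ext RegStr.IdxJ).renorm (D.extendChar g RegStr.IdxJ)
            (RegStr.telescope ord τ)) := by
  intro τ hτ
  let A := (D.ext RegStr.IdxI).model (RegStr.extNoise f fun _ => h) z ∘ₗ
    (D.ext RegStr.IdxI).renorm (D.extendChar g RegStr.IdxI)
  let B := (D.ext RegStr.IdxI).model (RegStr.extNoise f fun _ => k) z ∘ₗ
    (D.ext RegStr.IdxI).renorm (D.extendChar g RegStr.IdxI)
  let C := (D.ext RegStr.IdxJ).model (RegStr.extNoise f (RegStr.noiseJ h k)) z ∘ₗ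
    (D.ext RegStr.IdxJ).renorm (D.extendChar g RegStr.IdxJ) ∘ₗ RegStr.telescope ord
  change (A - B) τ = C τ
  -- Both sides are linear in `τ`, so single trees suffice; each is replaced by the concrete
  -- representative whose edges `ord` orders.
  rw [RegStr.Data.Tex, Finsupp.supported_eq_span_single] at hτ
  refine LinearMap.eqOn_span (f := A - B) (g := C) ?_ hτ
  rintro _ ⟨σ, hσ, rfl⟩
  have hσ' : (Quotient.out σ).Conforms (D.ext RegStr.IdxI) := by
    rw [← Quotient.out_eq σ] at hσ
    exact hσ.1
  have := D.telescope_tree g z (fun t => ⟨f t, hf t⟩) (fun t => ⟨h t, hh t⟩) (fun t => ⟨k t, hk t⟩)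
    hσ' (ord σ)
  have hout : (Quotient.mk _ (Quotient.out σ) : RegStr.Tree (RegStr.ExtTypes N P RegStr.IdxI) d) = σ :=
    Quotient.out_eq σ
  rw [hout] at this
  refine this.trans ?_
  have h1 : RegStr.telescope ord (Finsupp.single σ (1 : ℝ)) = _ :=
    (Finsupp.linearCombination_single ℝ _ _).trans (one_smul _ _)
  simp only [C, LinearMap.comp_apply]
  rw [h1, map_sum, map_sum]
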